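/- **Theorem 1.2.** Let $X, X_1, X_2, \dots$ be independent identically distributed random vectors in $\mathbb R^d$ with mean zero and identity covariance matrix $I_d$, let $Z_n = (X_1+\dots+X_n)/\sqrt n$, and let $\varphi(x) = (2\pi)^{-d/2} e^{-|x|^2/2}$ be the standard normal density on $\mathbb R^d$. If $Z_n$ has a density $p_n$, put $$T_\infty(p_n\|\varphi) = \operatorname*{ess\,sup}_{x\in\mathbb R^d} \frac{p_n(x)-\varphi(x)}{\varphi(x)} \in (-\infty, +\infty],$$ the essential supremum being with respect to Lebesgue measure; if $Z_n$ has no density, put $T_\infty(p_n\|\varphi) = +\infty$. Let $K(t) = \log \mathbb E\, e^{\langle t, X\rangle}$ and $A(t) = \tfrac12 |t|^2 - K(t)$ for $t \in \mathbb R^d$, and let $K''$, $A''$ denote the Hessian matrices. Assume that 1. $Z_{n}$ has a density $p_{n}$ with $T_\infty(p_{n}\|\varphi) < \infty$ for some $n = n_0 \ge 1$; 2. $X$ is strictly sub-Gaussian, that is, $\mathbb E\, e^{\langle t,X\rangle}<\infty$ and $A(t) \ge 0$ for all $t\in\mathbb R^d$. Then $T_\infty(p_n\|\varphi) \to 0$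 as $n\to\infty$ if and only if the following two conditions hold: a) $A''(t) = 0$ for every $t\in\mathbb R^d$ such that $A(t) = 0$; b) $\lim_{k\to\infty} A''(t_k) = 0$ for every sequence $(t_k)$ in $\mathbb R^d$ with $|t_k| \to\infty$ and $A(t_k)\to 0$ as $k\to\infty$. Moreover, $T_\infty(p_n\|\varphi) \to 0$ if and only if $\det K''(t) \to 1$ as $A(t)\to 0$, that is, for every $\varepsilon>0$ there is $\delta>0$ such that $|\det K''(t) - 1| \le \varepsilon$ for all $t$ with $A(t)\le\delta$. -/

import Mathlib

open MeasureTheory ProbabilityTheory Filter Topology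

noncomputable section

/-- The standard normal density `φ(x) = (2π)^(-d/2) exp(-|x|²/2)` on `ℝ^d`. -/
def stdNormalDensity (d : ℕ) (x : EuclideanSpace ℝ (Fin d)) : ℝ :=
  (2 * Real.pi) ^ (-(d : ℝ) / 2) * Real.exp (-‖x‖ ^ 2 / 2)

/-- `T_∞(p‖φ) = ess sup_x (p(x) - φ(x)) / φ(x)`, the essential supremum being with respect to
Lebesgue measure, for a probability distribution `ν` on `ℝ^d` with density `p`. It takes values in
the extended reals and is `+∞` if `ν` has no density. -/
def tsallisInf {d : ℕ} (ν : Measure (EuclideanSpace ℝ (Fin d))) : EReal :=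
  open scoped Classical in
  if ν ≪ volume then
    essSup (fun x => ((((ν.rnDeriv volume x).toReal - stdNormalDensity d x)
      / stdNormalDensity d x : ℝ) : EReal)) volume
  else ⊤

/-- The normalized sum `Z_n = (X_1 + ⋯ + X_n) / √n` (the sequence is indexed from `0`). -/
def normalizedSum {d : ℕ} {Ω : Type*} (X : ℕ → Ω → EuclideanSpace ℝ (Fin d)) (n : ℕ) (ω : Ω) :
    EuclideanSpace ℝ (Fin d) :=
  (Real.sqrt n)⁻¹ • ∑ i ∈ Finset.range n, X i ω

/-- The log-Laplace transform `K(t) = log E exp⟨t, X⟩`. -/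
def logLaplace {d : ℕ} {Ω : Type*} [MeasurableSpace Ω] (P : Measure Ω)
    (X : Ω → EuclideanSpace ℝ (Fin d)) (t : EuclideanSpace ℝ (Fin d)) : ℝ :=
  Real.log (∫ ω, Real.exp (inner ℝ t (X ω)) ∂P)

/-- The function `A(t) = |t|²/2 - K(t)`. -/
def gaussGap {d : ℕ} {Ω : Type*} [MeasurableSpace Ω] (P : Measure Ω)
    (X : Ω → EuclideanSpace ℝ (Fin d)) (t : EuclideanSpace ℝ (Fin d)) : ℝ :=
  ‖t‖ ^ 2 / 2 - logLaplace P X t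

/-- `X` is strictly sub-Gaussian: its Laplace transform is finite everywhere and `A ≥ 0`. -/
def StrictlySubGaussian {d : ℕ} {Ω : Type*} [MeasurableSpace Ω] (P : Measure Ω)
    (X : Ω → EuclideanSpace ℝ (Fin d)) : Prop :=
  ∀ t : EuclideanSpace ℝ (Fin d),
    Integrable (fun ω => Real.exp (inner ℝ t (X ω))) P ∧ 0 ≤ gaussGap P X t

/-- The covariance matrix of `X`. -/
def covMatrix {d : ℕ} {Ω : Type*} [MeasurableSpace Ω] (P : Measure Ω)
    (X : Ω → EuclideanSpace ℝ (Fin d)) : Matrix (Fin d) (Fin d) ℝ :=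
  Matrix.of fun i j => covariance (fun ω => X ω i) (fun ω => X ω j) P

/-- The Hessian of `f` at `t`: the matrix of second order partial derivatives. -/
def hessianMatrix {d : ℕ} (f : EuclideanSpace ℝ (Fin d) → ℝ) (t : EuclideanSpace ℝ (Fin d)) :
    Matrix (Fin d) (Fin d) ℝ :=
  Matrix.of fun i j =>
    fderiv ℝ (fun s => fderiv ℝ f s (EuclideanSpace.single j 1)) t (EuclideanSpace.single i 1)

end

/-!
The proof compares the law of `S_n = X_1 + ⋯ + X_n` with a Gaussian law by exponential tilting. Write
`f_{n,h}` for the density of the law of `S_n` tilted by `exp ⟨h, x⟩`. Completing the square, the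
inequality `p_n ≤ c φ` says that, for every tilt `h`,

  `f_{n,h}(x) ≤ c (2πn)^(-d/2) exp (n A(h)) exp (-|x - n h|² / (2n))`,

and conversely the bounds `f_{n,h} ≤ c (2πn)^(-d/2) exp (n A(h))` for all `h`, each used at the point
`x = n h`, give back `p_n ≤ c φ` (`expTilt_le_of_le_gaussian`, `le_gaussian_of_forall_expTilt_le`).
Since `T_∞ ≥ 0` by comparison of the total masses, `T_∞ → 0` means that `p_n ≤ (1 + ε) φ` for all
large `n`. It is shown that

  `T_∞ → 0` implies `K'' → I` along `A → 0`, which implies `det K'' → 1` along `A → 0`, which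
  implies `T_∞ → 0`.

If `det K''(h) → 1`: the tilted law of `S_n` is the law of a sum of `n` independent copies of the
tilted vector, whose covariance matrix is `K''(h)`, so a local limit theorem predicts
`sup f_{n,h} ≈ (2πn)^(-d/2) (det K''(h))^(-1/2)`. This is needed as an upper bound, uniformly over
`A(h) ≤ 1` (`exists_uniform_local_limit_bound`). Fourier inversion
(`le_smul_volume_of_integrable_charFun`) bounds the density by the integral of a power of `|v|²`,
where `v` is the characteristic function of the tilted law of `S_{n₀}`, and `|v|²` is the
characteristic function of a symmetrization. The density bound for `p_{n₀}` controls, uniformly in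
`h`, the integral of `|v|²` (`integral_sq_charFun_le`) and the moments of the tilted law. Laplace's
method then applies with uniform errors (`exists_uniform_laplace_bound`): `|v|²` cannot be close to
`1` away from the origin, as it would then be large near many multiples of this point and its
integral would be too large (`exists_cosTransform_le_exp`). For `A(h) ≥ δ` the factor `exp (n A(h))`
beats the crude bound `f_{n,h} ≤ C exp (n₀ A(h))`, which gives `p_n ≤ (1 + ε) φ`
(`eventually_sumLaw_le_gaussian`).

If `p_n ≤ (1 + ε) φ` for one `n`, then for `n A(h) ≤ ε` the tilted law of `(S_n - n h)/√n` is at most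
`a` times the standard Gaussian law with `a = (1 + ε) exp ε` close to `1`. Two probability measures
related in this way have almost the same moments of order one and two
(`abs_integral_sub_le_of_le_smul`), so that `K''(h)`, the covariance matrix of the tilted law, is
close to `I` (`tendsto_hessianMatrix_logLaplace`).

Finally `A'' = I - K''`, and the convergence `A'' → 0` along `A → 0` is tested on the zeros of `A`
and on the sequences that escape to infinity, because bounded sequences have convergent subsequences
(`tendsto_comap_nhds_zero_iff`).
-/

noncomputable section

/-! ### Characteristic functions and bounded densities -/

section Fourier

open Module Complex
open scoped ENNReal RealInnerProductSpace ComplexConjugate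

variable {E : Type*} [NormedAddCommGroup E] [InnerProductSpace ℝ E] [FiniteDimensional ℝ E]
  [MeasurableSpace E] [BorelSpace E]

theorem integrable_exp_neg_mul_sq_norm {b : ℝ} (hb : 0 < b) :
    Integrable fun t : E => Real.exp (-b * ‖t‖ ^ 2) := by
  have h := (GaussianFourier.integrable_cexp_neg_mul_sq_norm_add (V := E) (b := (b : ℂ))
    (by simpa using hb) 0 0).norm
  refine h.congr (Eventually.of_forall fun t => ?_)
  simp only [Complex.norm_exp]
  congr 1
  rw [zero_mul, add_zero, ← ofReal_pow, ← ofReal_neg, ← ofReal_mul, ofReal_re]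

theorem integral_cexp_inner_mul_gaussian {b : ℝ} (hb : 0 < b) (x : E) :
    ∫ t : E, cexp (⟪x, t⟫ * I) * (Real.exp (-b * ‖t‖ ^ 2) : ℂ) =
      (((Real.pi / b) ^ ((finrank ℝ E : ℝ) / 2) * Real.exp (-‖x‖ ^ 2 / (4 * b)) : ℝ) : ℂ) := by
  have h := GaussianFourier.integral_cexp_neg_mul_sq_norm_add (V := E) (b := (b : ℂ))
    (by simpa using hb) I x
  rw [ofReal_mul, ofReal_cpow (by positivity)]
  push_cast
  have h2 : (I ^ 2 * (‖x‖ : ℂ) ^ 2) / (4 * b) = -(‖x‖ : ℂ) ^ 2 / (4 * b) := by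
    rw [I_sq]; ring
  rw [← h2, ← h]
  congr 1 with t
  rw [← Complex.exp_add]
  congr 1
  ring

/-- Both sides are the double integral of `exp (i⟨x, t⟩ - b|t|²)`. -/
theorem integral_gaussian_eq_integral_charFun (τ : Measure E) [IsFiniteMeasure τ] {b : ℝ}
    (hb : 0 < b) :
    ((∫ x, (Real.pi / b) ^ ((finrank ℝ E : ℝ) / 2) * Real.exp (-‖x‖ ^ 2 / (4 * b)) ∂τ : ℝ) : ℂ) =
      ∫ t, charFun τ t * (Real.exp (-b * ‖t‖ ^ 2) : ℂ) := by
  rw [← integral_complex_ofReal]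
  simp_rw [← integral_cexp_inner_mul_gaussian hb, charFun_apply, ← integral_mul_const]
  refine integral_integral_swap ?_
  have h1 : Integrable (fun p : E × E => (1 : ℝ) * Real.exp (-b * ‖p.2‖ ^ 2)) (τ.prod volume) :=
    (integrable_const (1 : ℝ)).mul_prod (integrable_exp_neg_mul_sq_norm hb)
  refine h1.mono (by fun_prop) (Eventually.of_forall fun p => ?_)
  simp only [Function.uncurry, norm_mul, one_mul, Complex.norm_exp_ofReal_mul_I, Complex.norm_real,
    le_refl]

/-- The law of `Y - Y'` for independent `Y`, `Y'` with law `ρ`. -/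
def symmetrization (ρ : Measure E) : Measure E :=
  (ρ.prod ρ).map fun p => p.1 - p.2

instance (ρ : Measure E) [IsProbabilityMeasure ρ] : IsProbabilityMeasure (symmetrization ρ) :=
  Measure.isProbabilityMeasure_map (by fun_prop)

theorem charFun_symmetrization (ρ : Measure E) [IsProbabilityMeasure ρ] (t : E) :
    charFun (symmetrization ρ) t = ((‖charFun ρ t‖ ^ 2 : ℝ) : ℂ) := by
  rw [charFun_apply, symmetrization, integral_map (by fun_prop) (by fun_prop)]
  have h : ∀ p : E × E, cexp (⟪p.1 - p.2, t⟫ * I) =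
      cexp (⟪p.1, t⟫ * I) * cexp (⟪p.2, -t⟫ * I) := by
    intro p
    rw [← Complex.exp_add, inner_sub_left, inner_neg_right]
    push_cast
    ring_nf
  simp_rw [h]
  rw [integral_prod_mul (fun x : E => cexp (⟪x, t⟫ * I)) (fun x : E => cexp (⟪x, -t⟫ * I)),
    ← charFun_apply, ← charFun_apply, charFun_neg, Complex.mul_conj, Complex.normSq_eq_norm_sq]

theorem sq_norm_charFun_eq_integral_cos (ρ : Measure E) [IsProbabilityMeasure ρ] (t : E) :
    ‖charFun ρ t‖ ^ 2 = ∫ x, Real.cos ⟪x, t⟫ ∂(symmetrization ρ) := by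
  have h := congrArg Complex.re (charFun_symmetrization ρ t)
  rw [ofReal_re] at h
  have hint : Integrable (fun x : E => cexp (⟪x, t⟫ * I)) (symmetrization ρ) :=
    (integrable_const (1 : ℝ)).mono (by fun_prop)
      (Eventually.of_forall fun x => by simp [Complex.norm_exp_ofReal_mul_I])
  have h2 : (charFun (symmetrization ρ) t).re =
      ∫ x, (cexp (⟪x, t⟫ * I)).re ∂(symmetrization ρ) := (integral_re hint).symm
  rw [← h, h2]
  congr 1 with x
  rw [Complex.exp_ofReal_mul_I_re]

theorem lintegral_gaussian_heat {b : ℝ} (hb : 0 < b) (y : E) :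
    ∫⁻ x : E, ENNReal.ofReal ((Real.pi / b) ^ ((finrank ℝ E : ℝ) / 2) *
        Real.exp (-‖x - y‖ ^ 2 / (4 * b))) =
      ENNReal.ofReal ((2 * Real.pi) ^ finrank ℝ E) := by
  have hb' : 0 < (4 * b)⁻¹ := by positivity
  have e : ∀ x : E, -‖x - y‖ ^ 2 / (4 * b) = -(4 * b)⁻¹ * ‖x - y‖ ^ 2 := fun x => by
    field_simp
  simp_rw [e]
  rw [lintegral_sub_right_eq_self (fun x : E => ENNReal.ofReal
    ((Real.pi / b) ^ ((finrank ℝ E : ℝ) / 2) * Real.exp (-(4 * b)⁻¹ * ‖x‖ ^ 2))) y,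
    ← ofReal_integral_eq_lintegral_ofReal
      ((integrable_exp_neg_mul_sq_norm hb').const_mul _)
      (Eventually.of_forall fun x => by positivity),
    integral_const_mul, GaussianFourier.integral_rexp_neg_mul_sq_norm hb',
    ← Real.mul_rpow (by positivity) (by positivity)]
  congr 1
  have : Real.pi / b * (Real.pi / (4 * b)⁻¹) = (2 * Real.pi) ^ (2 : ℝ) := by
    rw [Real.rpow_two]; field_simp; ring
  rw [this, ← Real.rpow_mul (by positivity), ← Real.rpow_natCast]
  congr 1
  ring

/-- One half of Plancherel's theorem: a measure with density at most `M` has its characteristic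
function in `L²`. The integral is regularized by a Gaussian weight, under which it equals the
integral of a heat kernel. -/
theorem lintegral_sq_charFun_le (ρ : Measure E) [IsProbabilityMeasure ρ] {M : ℝ} (hM : 0 ≤ M)
    (hρ : ρ ≤ ENNReal.ofReal M • volume) :
    ∫⁻ t, ENNReal.ofReal (‖charFun ρ t‖ ^ 2) ≤ ENNReal.ofReal ((2 * Real.pi) ^ finrank ℝ E * M) := by
  have key : ∀ b : ℝ, 0 < b →
      ∫⁻ t, ENNReal.ofReal (‖charFun ρ t‖ ^ 2 * Real.exp (-b * ‖t‖ ^ 2)) ≤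
        ENNReal.ofReal ((2 * Real.pi) ^ finrank ℝ E * M) := by
    intro b hb
    have h := integral_gaussian_eq_integral_charFun (symmetrization ρ) hb
    simp_rw [charFun_symmetrization, ← ofReal_mul] at h
    rw [integral_complex_ofReal, ofReal_inj] at h
    have hi : Integrable fun t : E => ‖charFun ρ t‖ ^ 2 * Real.exp (-b * ‖t‖ ^ 2) := by
      refine (integrable_exp_neg_mul_sq_norm hb).bdd_mul (c := 1) ?_ ?_
      · exact ((measurable_charFun (μ := ρ)).norm.pow_const 2).aestronglyMeasurable
      · refine Eventually.of_forall fun t => ?_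
        have := norm_charFun_le_one (μ := ρ) t
        rw [Real.norm_eq_abs, abs_of_nonneg (by positivity)]
        exact pow_le_one₀ (norm_nonneg _) this
    rw [← ofReal_integral_eq_lintegral_ofReal hi (Eventually.of_forall fun t => by positivity),
      ← h, symmetrization, integral_map (by fun_prop) (by fun_prop),
      ofReal_integral_eq_lintegral_ofReal, lintegral_prod_symm _ (by fun_prop)]
    · calc ∫⁻ y, ∫⁻ x, ENNReal.ofReal ((Real.pi / b) ^ ((finrank ℝ E : ℝ) / 2) *
              Real.exp (-‖x - y‖ ^ 2 / (4 * b))) ∂ρ ∂ρ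
          ≤ ∫⁻ y, ENNReal.ofReal M * ENNReal.ofReal ((2 * Real.pi) ^ finrank ℝ E) ∂ρ := by
            refine lintegral_mono fun y => ?_
            refine (lintegral_mono' hρ le_rfl).trans ?_
            rw [lintegral_smul_measure, lintegral_gaussian_heat hb, smul_eq_mul]
        _ = _ := by
            rw [lintegral_const, measure_univ, mul_one, ← ENNReal.ofReal_mul hM, mul_comm]
    · refine (integrable_const ((Real.pi / b) ^ ((finrank ℝ E : ℝ) / 2))).mono (by fun_prop)
        (Eventually.of_forall fun p => ?_)
      rw [Real.norm_of_nonneg (by positivity), Real.norm_of_nonneg (by positivity)]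
      refine mul_le_of_le_one_right (by positivity) (Real.exp_le_one_iff.2 ?_)
      exact div_nonpos_of_nonpos_of_nonneg (by simp) (by positivity)
    · exact Eventually.of_forall fun p => by positivity
  have hlim : ∀ t : E, Tendsto (fun n : ℕ => ENNReal.ofReal (‖charFun ρ t‖ ^ 2 *
      Real.exp (-(1 / ((n : ℝ) + 1)) * ‖t‖ ^ 2))) atTop (𝓝 (ENNReal.ofReal (‖charFun ρ t‖ ^ 2))) := by
    intro t
    refine ENNReal.tendsto_ofReal ?_
    have h0 := tendsto_one_div_add_atTop_nhds_zero_nat (𝕜 := ℝ)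
    have := (((h0.neg).mul_const (‖t‖ ^ 2)).rexp).const_mul (‖charFun ρ t‖ ^ 2)
    simpa using this
  calc ∫⁻ t, ENNReal.ofReal (‖charFun ρ t‖ ^ 2)
      = ∫⁻ t, liminf (fun n : ℕ => ENNReal.ofReal (‖charFun ρ t‖ ^ 2 *
          Real.exp (-(1 / ((n : ℝ) + 1)) * ‖t‖ ^ 2))) atTop := by
        congr 1 with t; exact (hlim t).liminf_eq.symm
    _ ≤ liminf (fun n : ℕ => ∫⁻ t, ENNReal.ofReal (‖charFun ρ t‖ ^ 2 *
          Real.exp (-(1 / ((n : ℝ) + 1)) * ‖t‖ ^ 2))) atTop := by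
        refine lintegral_liminf_le fun n => ?_
        have := measurable_charFun (μ := ρ)
        fun_prop
    _ ≤ _ := by
        refine liminf_le_of_le (by isBoundedDefault) fun a ha => ?_
        obtain ⟨n, hn⟩ := ha.exists
        exact hn.trans (key _ (by positivity))

theorem integral_sq_charFun_le (ρ : Measure E) [IsProbabilityMeasure ρ] {M : ℝ} (hM : 0 ≤ M)
    (hρ : ρ ≤ ENNReal.ofReal M • volume) :
    Integrable (fun t => ‖charFun ρ t‖ ^ 2) ∧
      ∫ t, ‖charFun ρ t‖ ^ 2 ≤ (2 * Real.pi) ^ finrank ℝ E * M := by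
  have h := lintegral_sq_charFun_le ρ hM hρ
  have hm : Measurable fun t : E => ‖charFun ρ t‖ ^ 2 :=
    (measurable_charFun (μ := ρ)).norm.pow_const 2
  have hi : Integrable (fun t => ‖charFun ρ t‖ ^ 2) := by
    refine ⟨hm.aestronglyMeasurable, ?_⟩
    rw [hasFiniteIntegral_iff_ofReal (Eventually.of_forall fun t => by positivity)]
    exact h.trans_lt ENNReal.ofReal_lt_top
  refine ⟨hi, ?_⟩
  rw [← ofReal_integral_eq_lintegral_ofReal hi (Eventually.of_forall fun t => by positivity)] at h
  exact (ENNReal.ofReal_le_ofReal_iff (by positivity)).1 h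

/-- The mass that the heat kernel centred at a point of an open set gives to this set tends to `1`
as the time tends to `0`. -/
theorem tendsto_lintegral_heat_isOpen {U : Set E} (hU : IsOpen U) (hUm : volume U ≠ ∞) {x : E}
    (hx : x ∈ U) :
    Tendsto (fun c : ℝ => ∫⁻ y in U, ENNReal.ofReal ((Real.pi * c) ^ ((finrank ℝ E : ℝ) / 2) *
      Real.exp (-Real.pi ^ 2 * c * ‖x - y‖ ^ 2))) atTop (𝓝 1) := by
  let f : E → ℂ := U.indicator fun _ => 1
  have hf : Integrable f := (integrable_indicator_iff hU.measurableSet).2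
    (integrableOn_const (hs := hUm))
  have hc : ContinuousAt f x := by
    refine (continuousAt_const (y := (1 : ℂ))).congr ?_
    filter_upwards [hU.mem_nhds hx] with y hy
    simp [f, hy]
  have h := Real.tendsto_integral_gaussian_smul' hf hc
  have hfx : f x = 1 := by simp [f, hx]
  rw [hfx] at h
  have h2 := ENNReal.tendsto_ofReal ((Complex.continuous_re.tendsto _).comp h)
  rw [Complex.one_re, ENNReal.ofReal_one] at h2
  refine h2.congr' ?_
  filter_upwards [eventually_gt_atTop 0] with c hc
  have hpc : 0 < Real.pi ^ 2 * c := by positivity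
  have hint : Integrable fun y : E => Real.exp (-Real.pi ^ 2 * c * ‖x - y‖ ^ 2) := by
    have := (integrable_exp_neg_mul_sq_norm (E := E) hpc).comp_sub_left x
    simpa [neg_mul] using this
  rw [← ofReal_integral_eq_lintegral_ofReal (hint.const_mul _).integrableOn
    (Eventually.of_forall fun y => by positivity)]
  congr 1
  rw [← integral_indicator hU.measurableSet, ← Complex.ofReal_re (∫ _, _), ← integral_complex_ofReal]
  simp only [Function.comp_apply]
  congr 2 with y
  by_cases hy : y ∈ U
  · simp only [f, Set.indicator_of_mem hy, smul_eq_mul, mul_one]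
    rw [ofReal_mul, ofReal_cpow (by positivity)]
    push_cast
    rfl
  · simp [f, Set.indicator_of_notMem hy]

theorem lintegral_heat_le (ρ : Measure E) [IsProbabilityMeasure ρ] (hi : Integrable (charFun ρ))
    {c : ℝ} (hc : 0 < c) (y : E) :
    ∫⁻ x, ENNReal.ofReal ((Real.pi * c) ^ ((finrank ℝ E : ℝ) / 2) *
      Real.exp (-Real.pi ^ 2 * c * ‖x - y‖ ^ 2)) ∂ρ ≤
      ENNReal.ofReal (((2 * Real.pi) ^ finrank ℝ E)⁻¹ * ∫ t, ‖charFun ρ t‖) := by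
  set b : ℝ := (4 * Real.pi ^ 2 * c)⁻¹ with hbdef
  have hb : 0 < b := by positivity
  have hp : IsProbabilityMeasure (ρ.map fun x => x + -y) :=
    Measure.isProbabilityMeasure_map (by fun_prop)
  have h := integral_gaussian_eq_integral_charFun (ρ.map fun x => x + -y) hb
  have hle : ∫ x, (Real.pi / b) ^ ((finrank ℝ E : ℝ) / 2) * Real.exp (-‖x - y‖ ^ 2 / (4 * b)) ∂ρ ≤
      ∫ t, ‖charFun ρ t‖ := by
    rw [integral_map (by fun_prop) (by fun_prop)] at h
    simp only [← sub_eq_add_neg] at h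
    have h3 := congrArg norm h
    rw [Complex.norm_real, Real.norm_of_nonneg (integral_nonneg fun x => by positivity)] at h3
    rw [h3]
    refine (norm_integral_le_integral_norm _).trans ?_
    refine integral_mono_of_nonneg (Eventually.of_forall fun t => norm_nonneg _) hi.norm
      (Eventually.of_forall fun t => ?_)
    simp only [norm_mul, Complex.norm_real, Real.norm_eq_abs, Real.abs_exp]
    have e1 : ‖charFun (ρ.map fun x => x - y) t‖ = ‖charFun ρ t‖ := by
      simp_rw [sub_eq_add_neg]
      rw [charFun_map_add_const, norm_mul, Complex.norm_exp_ofReal_mul_I, mul_one]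
    rw [e1]
    refine mul_le_of_le_one_right (norm_nonneg _) (Real.exp_le_one_iff.2 ?_)
    have := mul_nonneg hb.le (sq_nonneg ‖t‖)
    linarith
  have hpow : (Real.pi * c) ^ ((finrank ℝ E : ℝ) / 2) =
      ((2 * Real.pi) ^ finrank ℝ E)⁻¹ * (Real.pi / b) ^ ((finrank ℝ E : ℝ) / 2) := by
    have e : Real.pi / b = (2 * Real.pi) ^ (2 : ℝ) * (Real.pi * c) := by
      rw [Real.rpow_two, hbdef]; field_simp; ring
    rw [e, Real.mul_rpow (x := (2 * Real.pi) ^ (2 : ℝ)) (by positivity) (by positivity),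
      ← Real.rpow_mul (by positivity),
      ← Real.rpow_natCast, mul_div_cancel₀ _ (two_ne_zero' ℝ), inv_mul_cancel_left₀]
    positivity
  have hexp : ∀ x : E, -Real.pi ^ 2 * c * ‖x - y‖ ^ 2 = -‖x - y‖ ^ 2 / (4 * b) := by
    intro x
    rw [hbdef]; field_simp
  simp_rw [hexp, hpow, mul_assoc]
  rw [← ofReal_integral_eq_lintegral_ofReal]
  · rw [integral_const_mul]
    exact ENNReal.ofReal_le_ofReal (mul_le_mul_of_nonneg_left hle (by positivity))
  · refine Integrable.const_mul ?_ _
    refine (integrable_const ((Real.pi / b) ^ ((finrank ℝ E : ℝ) / 2))).mono (by fun_prop)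
      (Eventually.of_forall fun p => ?_)
    rw [Real.norm_of_nonneg (by positivity), Real.norm_of_nonneg (by positivity)]
    refine mul_le_of_le_one_right (by positivity) (Real.exp_le_one_iff.2 ?_)
    exact div_nonpos_of_nonpos_of_nonneg (by simp) (by positivity)
  · exact Eventually.of_forall fun p => by positivity

/-- Fourier inversion in the form of a bound: a measure with integrable characteristic function has
a density at most `(2π)^(-d) ∫ |charFun|`. -/
theorem le_smul_volume_of_integrable_charFun (ρ : Measure E) [IsProbabilityMeasure ρ]
    (hi : Integrable (charFun ρ)) :
    ρ ≤ ENNReal.ofReal (((2 * Real.pi) ^ finrank ℝ E)⁻¹ * ∫ t, ‖charFun ρ t‖) • volume := by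
  set J := ENNReal.ofReal (((2 * Real.pi) ^ finrank ℝ E)⁻¹ * ∫ t, ‖charFun ρ t‖)
  have hopen : ∀ U : Set E, IsOpen U → volume U ≠ ∞ → ρ U ≤ J * volume U := by
    intro U hU hUm
    let G : ℕ → E → E → ℝ≥0∞ := fun n x y =>
      ENNReal.ofReal ((Real.pi * (n : ℝ)) ^ ((finrank ℝ E : ℝ) / 2) *
        Real.exp (-Real.pi ^ 2 * (n : ℝ) * ‖x - y‖ ^ 2))
    have hG : ∀ n, Measurable (Function.uncurry (G n)) := fun n => by
      unfold Function.uncurry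
      fun_prop
    calc ρ U = ∫⁻ x, U.indicator 1 x ∂ρ := (lintegral_indicator_one hU.measurableSet).symm
      _ ≤ ∫⁻ x, liminf (fun n : ℕ => ∫⁻ y in U, G n x y) atTop ∂ρ := by
          refine lintegral_mono fun x => ?_
          by_cases hx : x ∈ U
          · have h := ((tendsto_lintegral_heat_isOpen hU hUm hx).comp
              tendsto_natCast_atTop_atTop).liminf_eq
            simp only [Set.indicator_of_mem hx, Pi.one_apply]
            exact h.ge
          · simp [hx]
      _ ≤ liminf (fun n : ℕ => ∫⁻ x, (∫⁻ y in U, G n x y) ∂ρ) atTop :=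
          lintegral_liminf_le fun n => (hG n).lintegral_prod_right'
      _ ≤ J * volume U := by
          refine liminf_le_of_le (by isBoundedDefault) fun a ha => ?_
          obtain ⟨n, hn, hn1⟩ := (ha.and (eventually_ge_atTop 1)).exists
          refine hn.trans ?_
          rw [lintegral_lintegral_swap (hG n).aemeasurable]
          calc ∫⁻ y in U, ∫⁻ x, G n x y ∂ρ ≤ ∫⁻ _ in U, J :=
                lintegral_mono fun y => lintegral_heat_le ρ hi
                  (by exact_mod_cast Nat.lt_of_lt_of_le Nat.zero_lt_one hn1) y
            _ = J * volume U := by rw [setLIntegral_const]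
  refine Measure.le_iff.2 fun s hs => ?_
  rw [Measure.smul_apply, smul_eq_mul]
  by_cases hsm : volume s = ∞
  · by_cases hJ : J = 0
    · -- for `J = 0` the measure vanishes on balls, hence everywhere
      have h0 : ρ Set.univ = 0 := by
        rw [← Metric.iUnion_ball_nat 0, measure_iUnion_null_iff]
        intro n
        have := hopen (Metric.ball 0 n) Metric.isOpen_ball measure_ball_lt_top.ne
        simpa [hJ] using this
      simp at h0
    · rw [hsm, ENNReal.mul_top hJ]
      exact le_top
  · refine ENNReal.le_of_forall_pos_le_add fun ε hε hfin => ?_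
    have hJt : J ≠ ∞ := ENNReal.ofReal_ne_top
    have hε' : (ε : ℝ≥0∞) / (J + 1) ≠ 0 := by
      simp [ENNReal.div_eq_zero_iff, hε.ne', hJt]
    obtain ⟨U, hsU, hU, hUle⟩ := s.exists_isOpen_lt_add hsm hε'
    calc ρ s ≤ ρ U := measure_mono hsU
      _ ≤ J * volume U := hopen U hU (hUle.trans_le le_top).ne
      _ ≤ J * (volume s + ε / (J + 1)) := by gcongr
      _ = J * volume s + J * (ε / (J + 1)) := mul_add _ _ _
      _ ≤ J * volume s + ε := by
          gcongr
          calc J * (ε / (J + 1)) ≤ (J + 1) * (ε / (J + 1)) := by gcongr; exact le_self_add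
            _ = ε := ENNReal.mul_div_cancel (by simp) (by simp [hJt])

end Fourier

/-! ### The Laplace method for characteristic functions of symmetric laws -/

section CosTransform

open Module
open scoped ENNReal RealInnerProductSpace

theorem one_sub_cos_eq (x : ℝ) : 1 - Real.cos x = 2 * Real.sin (x / 2) ^ 2 := by
  have h := Real.cos_sq' (x / 2)
  have h2 := Real.cos_two_mul (x / 2)
  rw [mul_div_cancel₀ x (two_ne_zero' ℝ)] at h2
  linarith

theorem abs_sin_nat_mul_le (k : ℕ) (x : ℝ) : |Real.sin (k * x)| ≤ k * |Real.sin x| := by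
  induction k with
  | zero => simp
  | succ k ih =>
    push_cast
    rw [add_mul, one_mul, Real.sin_add, add_mul, one_mul]
    refine (abs_add_le _ _).trans (add_le_add ?_ ?_)
    · rw [abs_mul]
      exact (mul_le_of_le_one_right (abs_nonneg _) (Real.abs_cos_le_one _)).trans ih
    · rw [abs_mul]
      exact mul_le_of_le_one_left (abs_nonneg _) (Real.abs_cos_le_one _)

theorem one_sub_cos_nat_mul_le (k : ℕ) (x : ℝ) :
    1 - Real.cos (k * x) ≤ (k : ℝ) ^ 2 * (1 - Real.cos x) := by
  rw [one_sub_cos_eq, one_sub_cos_eq, mul_div_assoc]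
  have h := pow_le_pow_left₀ (abs_nonneg _) (abs_sin_nat_mul_le k (x / 2)) 2
  rw [mul_pow, sq_abs, sq_abs] at h
  linarith

theorem one_sub_cos_add_le (x y : ℝ) :
    1 - Real.cos (x + y) ≤ 2 * (1 - Real.cos x) + 2 * (1 - Real.cos y) := by
  rw [one_sub_cos_eq, one_sub_cos_eq, one_sub_cos_eq, add_div, Real.sin_add]
  set a := Real.sin (x / 2)
  set b := Real.sin (y / 2)
  set c := Real.cos (x / 2)
  set d := Real.cos (y / 2)
  have hc : c ^ 2 ≤ 1 := Real.cos_sq_le_one _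
  have hd : d ^ 2 ≤ 1 := Real.cos_sq_le_one _
  have h1 : a ^ 2 * d ^ 2 ≤ a ^ 2 := mul_le_of_le_one_right (sq_nonneg _) hd
  have h2 : c ^ 2 * b ^ 2 ≤ b ^ 2 := mul_le_of_le_one_left (sq_nonneg _) hc
  nlinarith [sq_nonneg (a * d - c * b)]

theorem cos_le_one_sub_sq_add_pow_four (x : ℝ) : Real.cos x ≤ 1 - x ^ 2 / 2 + x ^ 4 / 2 := by
  rcases le_total |x| 1 with h | h
  · have h1 := (abs_le.1 (Real.cos_bound h)).2
    have h2 : |x| ^ 4 = x ^ 4 := by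
      rw [← abs_pow, abs_of_nonneg (by positivity)]
    rw [h2] at h1
    have : 0 ≤ x ^ 4 := by positivity
    linarith
  · have h1 : 1 ≤ x ^ 2 := by rw [← sq_abs]; exact one_le_pow₀ h
    nlinarith [Real.cos_le_one x]

variable {E : Type*} [NormedAddCommGroup E] [InnerProductSpace ℝ E]
  [MeasurableSpace E]

/-- The real part of the characteristic function of `τ`; it is the characteristic function itself
if `τ` is symmetric. -/
def cosTransform (τ : Measure E) (t : E) : ℝ := ∫ x, Real.cos ⟪x, t⟫ ∂τ

/-- Half of the second moment of `τ` in the direction `t`. If `τ` is the symmetrization of `ρ`, this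
is the variance of `ρ` in the direction `t`. -/
def halfSecondMoment (τ : Measure E) (t : E) : ℝ := ∫ x, ⟪x, t⟫ ^ 2 / 2 ∂τ

theorem halfSecondMoment_smul (τ : Measure E) (a : ℝ) (t : E) :
    halfSecondMoment τ (a • t) = a ^ 2 * halfSecondMoment τ t := by
  rw [halfSecondMoment, halfSecondMoment, ← integral_const_mul]
  congr 1 with x
  rw [real_inner_smul_right]
  ring

variable [BorelSpace E] [FiniteDimensional ℝ E] {τ : Measure E}

theorem integrable_inner_pow {k : ℕ} (h : Integrable (fun x => ‖x‖ ^ k) τ) (t : E) :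
    Integrable (fun x => ⟪x, t⟫ ^ k) τ := by
  refine (h.mul_const (‖t‖ ^ k)).mono (by fun_prop) (Eventually.of_forall fun x => ?_)
  rw [← mul_pow, norm_pow, norm_pow, norm_mul, norm_norm, norm_norm]
  exact pow_le_pow_left₀ (norm_nonneg _) (norm_inner_le_norm x t) k

theorem integral_inner_pow_le {k : ℕ} (h : Integrable (fun x => ‖x‖ ^ k) τ) (t : E) :
    ∫ x, ⟪x, t⟫ ^ k ∂τ ≤ (∫ x, ‖x‖ ^ k ∂τ) * ‖t‖ ^ k := by
  rw [← integral_mul_const]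
  refine integral_mono (integrable_inner_pow h t) (h.mul_const _) fun x => ?_
  refine (le_abs_self _).trans ?_
  simp only [abs_pow]
  rw [← mul_pow]
  exact pow_le_pow_left₀ (abs_nonneg _) (abs_real_inner_le_norm x t) k

theorem continuous_halfSecondMoment (h2 : Integrable (fun x => ‖x‖ ^ 2) τ) :
    Continuous (halfSecondMoment τ) := by
  refine continuous_iff_continuousAt.2 fun t₀ => ?_
  refine continuousAt_of_dominated (bound := fun x => ‖x‖ ^ 2 * (‖t₀‖ + 1) ^ 2 / 2)
    (Eventually.of_forall fun t => by fun_prop) ?_ ((h2.mul_const _).div_const _)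
    (Eventually.of_forall fun x => by fun_prop)
  filter_upwards [Metric.ball_mem_nhds t₀ one_pos] with t ht
  refine Eventually.of_forall fun x => ?_
  have h1 : ‖t‖ ≤ ‖t₀‖ + 1 := by
    have := norm_sub_norm_le t t₀
    have h3 := mem_ball_iff_norm.1 ht
    linarith
  rw [Real.norm_of_nonneg (by positivity), ← mul_pow, ← sq_abs ⟪x, t⟫]
  gcongr
  exact (abs_real_inner_le_norm x t).trans (by gcongr)

variable [IsProbabilityMeasure τ]

theorem integrable_cos_inner (τ : Measure E) [IsProbabilityMeasure τ] (t : E) :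
    Integrable (fun x => Real.cos ⟪x, t⟫) τ :=
  (integrable_const (1 : ℝ)).mono (by fun_prop)
    (Eventually.of_forall fun x => by simpa using Real.abs_cos_le_one _)

theorem one_sub_cosTransform (t : E) :
    1 - cosTransform τ t = ∫ x, (1 - Real.cos ⟪x, t⟫) ∂τ := by
  rw [integral_sub (integrable_const _) (integrable_cos_inner τ t)]
  simp [cosTransform]

theorem cosTransform_le_one (t : E) : cosTransform τ t ≤ 1 := by
  have : 0 ≤ 1 - cosTransform τ t := by
    rw [one_sub_cosTransform]
    exact integral_nonneg fun x => sub_nonneg.2 (Real.cos_le_one _)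
  linarith

theorem one_sub_cosTransform_nat_smul_le (k : ℕ) (t : E) :
    1 - cosTransform τ ((k : ℝ) • t) ≤ (k : ℝ) ^ 2 * (1 - cosTransform τ t) := by
  rw [one_sub_cosTransform, one_sub_cosTransform, ← integral_const_mul]
  refine integral_mono ((integrable_const _).sub (integrable_cos_inner τ _))
    (((integrable_const _).sub (integrable_cos_inner τ _)).const_mul _) fun x => ?_
  simp only [real_inner_smul_right]
  exact one_sub_cos_nat_mul_le k _

theorem one_sub_cosTransform_add_le (t u : E) :
    1 - cosTransform τ (t + u) ≤ 2 * (1 - cosTransform τ t) + 2 * (1 - cosTransform τ u) := by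
  simp only [one_sub_cosTransform]
  have hi : ∀ v : E, Integrable (fun x => 2 * (1 - Real.cos ⟪x, v⟫)) τ := fun v =>
    ((integrable_const _).sub (integrable_cos_inner τ _)).const_mul _
  rw [← integral_const_mul, ← integral_const_mul, ← integral_add (hi t) (hi u)]
  refine integral_mono ((integrable_const _).sub (integrable_cos_inner τ _))
    ((hi t).add (hi u)) fun x => ?_
  simp only [inner_add_right]
  exact one_sub_cos_add_le _ _

theorem one_sub_cosTransform_le_halfSecondMoment (h2 : Integrable (fun x => ‖x‖ ^ 2) τ) (t : E) :
    1 - cosTransform τ t ≤ halfSecondMoment τ t := by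
  rw [one_sub_cosTransform, halfSecondMoment]
  refine integral_mono ((integrable_const _).sub (integrable_cos_inner τ _))
    ((integrable_inner_pow h2 t).div_const _) fun x => ?_
  have := Real.one_sub_sq_div_two_le_cos (x := ⟪x, t⟫)
  simp only
  linarith

theorem cosTransform_le (h2 : Integrable (fun x => ‖x‖ ^ 2) τ)
    (h4 : Integrable (fun x => ‖x‖ ^ 4) τ) (t : E) :
    cosTransform τ t ≤ 1 - halfSecondMoment τ t + (∫ x, ‖x‖ ^ 4 ∂τ) / 2 * ‖t‖ ^ 4 := by
  have i2 := (integrable_inner_pow h2 t).div_const 2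
  have i3 : Integrable (fun x => 1 - ⟪x, t⟫ ^ 2 / 2) τ := (integrable_const _).sub i2
  have i4 := (integrable_inner_pow h4 t).div_const 2
  have h : cosTransform τ t ≤ ∫ x, (1 - ⟪x, t⟫ ^ 2 / 2 + ⟪x, t⟫ ^ 4 / 2) ∂τ :=
    integral_mono (integrable_cos_inner τ t) (i3.add i4)
      fun x => cos_le_one_sub_sq_add_pow_four _
  rw [integral_add i3 i4, integral_sub (integrable_const _) i2,
    integral_div _ (fun x : E => ⟪x, t⟫ ^ 4)] at h
  simp only [integral_const, probReal_univ, smul_eq_mul, mul_one] at h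
  have h5 := integral_inner_pow_le h4 t
  rw [halfSecondMoment]
  linarith

/-- If `cosTransform τ` is close to `1` at `t`, it is at least `1/2` on balls around many multiples
of `t`, so that its integral is large. Hence the integral bounds it away from `1`, with a
gap that depends only on the integral and on the second moment. -/
theorem exists_cosTransform_le_exp (B I : ℝ) {r : ℝ} (hr : 0 < r) :
    ∃ η : ℝ, 0 < η ∧ ∀ τ : Measure E, IsProbabilityMeasure τ →
      Integrable (fun x => ‖x‖ ^ 2) τ → ∫ x, ‖x‖ ^ 2 ∂τ ≤ B →
      (∀ t, 0 ≤ cosTransform τ t) → Integrable (cosTransform τ) → ∫ t, cosTransform τ t ≤ I →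
      ∀ t, r ≤ ‖t‖ → cosTransform τ t ≤ Real.exp (-η) := by
  -- balls of radius `r₀` around the multiples of `t` are disjoint, and `1 - cosTransform τ` is at
  -- most `1/8` on the ball of radius `r₀` around the origin
  set r₀ : ℝ := min (r / 2) (1 / (2 * (|B| + 1))) with hr₀
  have hr₀pos : 0 < r₀ := by positivity
  have hr₀B : |B| * r₀ ^ 2 ≤ 1 / 4 := by
    have h1 : r₀ * (2 * (|B| + 1)) ≤ 1 := by
      have := min_le_right (r / 2) (1 / (2 * (|B| + 1)))
      rwa [← hr₀, le_div_iff₀ (by positivity)] at this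
    have h2 : 0 ≤ |B| := abs_nonneg B
    have h3 : (r₀ * (2 * (|B| + 1))) ^ 2 ≤ 1 := pow_le_one₀ (by positivity) h1
    nlinarith [mul_nonneg (sq_nonneg r₀) h2, sq_nonneg r₀, mul_nonneg (sq_nonneg r₀) (sq_nonneg |B|)]
  set v : ℝ := volume.real (Metric.ball (0 : E) r₀)
  have hv : 0 < v := by
    refine ENNReal.toReal_pos (Metric.measure_ball_pos _ _ hr₀pos).ne' measure_ball_lt_top.ne
  obtain ⟨K, hK⟩ := exists_nat_gt (|I| / (v / 2))
  have hKpos : 0 < (K : ℝ) := lt_of_le_of_lt (by positivity) hK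
  refine ⟨1 / (8 * (K : ℝ) ^ 2), by positivity, fun τ hτ h2 hB hW hWi hI t ht => ?_⟩
  refine le_trans ?_ (Real.one_sub_le_exp_neg _)
  by_contra! hlt
  have hball : ∀ k ∈ Finset.range K, ∀ x ∈ Metric.ball (((k + 1 : ℕ) : ℝ) • t) r₀,
      1 / 2 ≤ cosTransform τ x := by
    intro k hk x hx
    have hk' : ((k + 1 : ℕ) : ℝ) ≤ K := by exact_mod_cast Finset.mem_range.1 hk
    have e1 := one_sub_cosTransform_nat_smul_le (τ := τ) (k + 1) t
    have e2 := one_sub_cosTransform_add_le (τ := τ) (((k + 1 : ℕ) : ℝ) • t)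
      (x - ((k + 1 : ℕ) : ℝ) • t)
    rw [add_sub_cancel] at e2
    set u := x - ((k + 1 : ℕ) : ℝ) • t
    have hu : ‖u‖ ≤ r₀ := (mem_ball_iff_norm.1 hx).le
    have e3 := one_sub_cosTransform_le_halfSecondMoment h2 u
    have e4 := integral_inner_pow_le h2 u
    have e5 : halfSecondMoment τ u = (∫ x, ⟪x, u⟫ ^ 2 ∂τ) / 2 := integral_div _ _
    have e6 : (∫ x, ‖x‖ ^ 2 ∂τ) * ‖u‖ ^ 2 ≤ |B| * r₀ ^ 2 :=
      mul_le_mul (hB.trans (le_abs_self B)) (pow_le_pow_left₀ (norm_nonneg _) hu 2)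
        (by positivity) (abs_nonneg _)
    have e7 : ((k + 1 : ℕ) : ℝ) ^ 2 * (1 - cosTransform τ t) ≤ 1 / 8 := by
      calc ((k + 1 : ℕ) : ℝ) ^ 2 * (1 - cosTransform τ t)
          ≤ (K : ℝ) ^ 2 * (1 / (8 * (K : ℝ) ^ 2)) :=
            mul_le_mul (pow_le_pow_left₀ (by positivity) hk' 2) (by linarith)
              (sub_nonneg.2 (cosTransform_le_one t)) (by positivity)
        _ = 1 / 8 := by field_simp
    linarith
  have hdisj : Set.PairwiseDisjoint (Finset.range K : Set ℕ)
      fun k : ℕ => Metric.ball (((k + 1 : ℕ) : ℝ) • t) r₀ := by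
    intro i _ j _ hij
    refine Metric.ball_disjoint_ball ?_
    rw [dist_eq_norm, ← sub_smul, norm_smul, Real.norm_eq_abs]
    have h1 : (1 : ℝ) ≤ |((i + 1 : ℕ) : ℝ) - ((j + 1 : ℕ) : ℝ)| := by
      have : (1 : ℤ) ≤ |((i + 1 : ℕ) : ℤ) - ((j + 1 : ℕ) : ℤ)| :=
        Int.one_le_abs (by omega)
      exact_mod_cast this
    have h2 : r₀ ≤ r / 2 := min_le_left _ _
    nlinarith [norm_nonneg t]
  have hle : (K : ℝ) * (v / 2) ≤ I := by
    calc (K : ℝ) * (v / 2)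
        = ∑ k ∈ Finset.range K, ∫ x in Metric.ball (((k + 1 : ℕ) : ℝ) • t) r₀, (1 / 2 : ℝ) := by
          simp only [setIntegral_const, smul_eq_mul, Finset.sum_const, Finset.card_range,
            nsmul_eq_mul, Measure.real, Measure.addHaar_ball_center, v]
          ring
      _ ≤ ∑ k ∈ Finset.range K, ∫ x in Metric.ball (((k + 1 : ℕ) : ℝ) • t) r₀,
            cosTransform τ x := by
          refine Finset.sum_le_sum fun k hk => ?_
          exact setIntegral_mono_on (integrableOn_const (hs := measure_ball_lt_top.ne))
            hWi.integrableOn measurableSet_ball (hball k hk)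
      _ = ∫ x in ⋃ k ∈ Finset.range K, Metric.ball (((k + 1 : ℕ) : ℝ) • t) r₀,
            cosTransform τ x :=
          (integral_biUnion_finset _ (fun _ _ => measurableSet_ball) hdisj
            fun _ _ => hWi.integrableOn).symm
      _ ≤ ∫ x, cosTransform τ x :=
          setIntegral_le_integral hWi (Eventually.of_forall hW)
      _ ≤ I := hI
  have := (div_lt_iff₀ (by positivity)).1 hK
  linarith [le_abs_self I]

theorem integrable_norm_pow_four_mul_gaussian {b : ℝ} (hb : 0 < b) :
    Integrable fun s : E => ‖s‖ ^ 4 * Real.exp (-b * ‖s‖ ^ 2) := by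
  refine ((integrable_exp_neg_mul_sq_norm (E := E) (half_pos hb)).const_mul (8 / b ^ 2)).mono
    (by fun_prop) (Eventually.of_forall fun s => ?_)
  rw [Real.norm_of_nonneg (by positivity), Real.norm_of_nonneg (by positivity)]
  have h := Real.pow_div_factorial_le_exp (b / 2 * ‖s‖ ^ 2) (by positivity) 2
  have e : Real.exp (-(b / 2) * ‖s‖ ^ 2) =
      Real.exp (b / 2 * ‖s‖ ^ 2) * Real.exp (-b * ‖s‖ ^ 2) := by
    rw [← Real.exp_add]; ring_nf
  rw [e, ← mul_assoc]
  refine mul_le_mul_of_nonneg_right ?_ (Real.exp_pos _).le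
  calc ‖s‖ ^ 4 = 8 / b ^ 2 * ((b / 2 * ‖s‖ ^ 2) ^ 2 / (Nat.factorial 2 : ℕ)) := by
        simp only [Nat.factorial]; field_simp; push_cast; ring
    _ ≤ _ := by gcongr

theorem integral_comp_sqrt_smul (f : E → ℝ) {m : ℝ} (hm : 0 < m) :
    m ^ ((finrank ℝ E : ℝ) / 2) * ∫ t, f (Real.sqrt m • t) = ∫ t, f t := by
  rw [Measure.integral_comp_smul, smul_eq_mul, abs_of_nonneg (by positivity), ← mul_assoc]
  have : m ^ ((finrank ℝ E : ℝ) / 2) = Real.sqrt m ^ finrank ℝ E := by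
    rw [Real.sqrt_eq_rpow, ← Real.rpow_natCast, ← Real.rpow_mul hm.le]
    congr 1
    ring
  rw [this, mul_inv_cancel₀ (by positivity), one_mul]

/-- Laplace's method for `∫ (cosTransform τ)^m` as `m → ∞`, as an upper bound with an error that is
uniform over all `τ` with given bounds for the second and fourth moments and for the integral of
`cosTransform τ`. -/
theorem exists_uniform_laplace_bound (B₂ B₄ I : ℝ) :
    ∃ c : ℝ, 0 < c ∧ ∃ err : ℝ → ℝ, Tendsto err atTop (𝓝 0) ∧
      ∀ τ : Measure E, IsProbabilityMeasure τ →
      Integrable (fun x => ‖x‖ ^ 2) τ → ∫ x, ‖x‖ ^ 2 ∂τ ≤ B₂ →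
      Integrable (fun x => ‖x‖ ^ 4) τ → ∫ x, ‖x‖ ^ 4 ∂τ ≤ B₄ →
      (∀ t, 0 ≤ cosTransform τ t) → Integrable (cosTransform τ) → ∫ t, cosTransform τ t ≤ I →
      (∀ t, c * ‖t‖ ^ 2 ≤ halfSecondMoment τ t) ∧
      ∀ m : ℝ, 1 ≤ m → m ^ ((finrank ℝ E : ℝ) / 2) * ∫ t, cosTransform τ t ^ m ≤
        (∫ t, Real.exp (-halfSecondMoment τ t)) + err m := by
  -- separation from `1` at distance `1` gives the lower bound for the quadratic form, since
  -- `1 - cosTransform τ` is at most `halfSecondMoment τ`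
  obtain ⟨η₁, hη₁, H₁⟩ := exists_cosTransform_le_exp (E := E) B₂ I one_pos
  set c : ℝ := 1 - Real.exp (-η₁) with hc
  have hcpos : 0 < c := sub_pos.2 (by rw [← Real.exp_zero]; exact Real.exp_lt_exp.2 (by linarith))
  set D : ℝ := (|B₄| + 1) / 2 with hD
  have hDpos : 0 < D := by positivity
  -- for `‖t‖ < r` the quartic term is at most half of `c ‖t‖²`
  set r : ℝ := Real.sqrt (c / (2 * D)) with hrdef
  have hr : 0 < r := Real.sqrt_pos.2 (by positivity)
  obtain ⟨η, hη, H₂⟩ := exists_cosTransform_le_exp (E := E) B₂ I hr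
  set G : ℝ := ∫ s : E, ‖s‖ ^ 4 * Real.exp (-(c / 2) * ‖s‖ ^ 2) with hG
  refine ⟨c, hcpos, fun m => D * G / m +
    m ^ ((finrank ℝ E : ℝ) / 2) * Real.exp (-η * m) * (Real.exp η * I), ?_, ?_⟩
  · have h1 : Tendsto (fun m : ℝ => D * G / m) atTop (𝓝 0) :=
      tendsto_const_nhds.div_atTop tendsto_id
    have h2 := (tendsto_rpow_mul_exp_neg_mul_atTop_nhds_zero ((finrank ℝ E : ℝ) / 2) η hη).mul_const
      (Real.exp η * I)
    simpa using h1.add h2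
  intro τ hτ h2 hB2 h4 hB4 hW hWi hI
  have hQ : ∀ t, c * ‖t‖ ^ 2 ≤ halfSecondMoment τ t := by
    intro t
    rcases eq_or_ne t 0 with rfl | ht
    · simp [halfSecondMoment]
    · have hn : 0 < ‖t‖ := norm_pos_iff.2 ht
      have e1 : ‖‖t‖⁻¹ • t‖ = 1 := by rw [norm_smul, norm_inv, norm_norm, inv_mul_cancel₀ hn.ne']
      have e2 := H₁ τ hτ h2 hB2 hW hWi hI (‖t‖⁻¹ • t) e1.ge
      have e3 := one_sub_cosTransform_le_halfSecondMoment h2 (‖t‖⁻¹ • t)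
      rw [halfSecondMoment_smul] at e3
      have e4 : c ≤ ‖t‖⁻¹ ^ 2 * halfSecondMoment τ t := by linarith
      calc c * ‖t‖ ^ 2 ≤ ‖t‖⁻¹ ^ 2 * halfSecondMoment τ t * ‖t‖ ^ 2 := by gcongr
        _ = halfSecondMoment τ t := by field_simp
  refine ⟨hQ, fun m hm => ?_⟩
  have hm0 : 0 < m := by linarith
  set Q := halfSecondMoment τ with hQdef
  have hQc : Continuous Q := continuous_halfSecondMoment h2
  have hpt : ∀ t, cosTransform τ t ^ m ≤ Real.exp (-(m * Q t)) +
      m * D * (‖t‖ ^ 4 * Real.exp (-(m * (c / 2)) * ‖t‖ ^ 2)) +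
      Real.exp (-η * (m - 1)) * cosTransform τ t := by
    intro t
    rcases lt_or_ge ‖t‖ r with ht | ht
    · have hDt : D * ‖t‖ ^ 2 ≤ c / 2 := by
        have : ‖t‖ ^ 2 ≤ c / (2 * D) := by
          rw [← Real.sq_sqrt (show 0 ≤ c / (2 * D) by positivity)]
          exact pow_le_pow_left₀ (norm_nonneg _) ht.le 2
        calc D * ‖t‖ ^ 2 ≤ D * (c / (2 * D)) := by gcongr
          _ = c / 2 := by field_simp
      have e1 : cosTransform τ t ≤ Real.exp (-(Q t) + D * ‖t‖ ^ 4) := by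
        have e2 := cosTransform_le h2 h4 t
        have e3 := Real.add_one_le_exp (-(Q t) + D * ‖t‖ ^ 4)
        have e4 : (∫ x, ‖x‖ ^ 4 ∂τ) / 2 * ‖t‖ ^ 4 ≤ D * ‖t‖ ^ 4 := by
          refine mul_le_mul_of_nonneg_right ?_ (by positivity)
          linarith [le_abs_self B₄]
        linarith
      set y : ℝ := m * D * ‖t‖ ^ 4 with hy
      have hy0 : 0 ≤ y := by positivity
      have e5 : cosTransform τ t ^ m ≤ Real.exp (-(m * Q t)) * Real.exp y := by
        refine (Real.rpow_le_rpow (hW t) e1 hm0.le).trans ?_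
        rw [← Real.exp_mul, ← Real.exp_add]
        exact (Real.exp_le_exp.2 (by rw [hy]; linarith)).trans le_rfl
      -- `exp y ≤ 1 + y exp y`, and half of the quadratic form absorbs the second `exp y`
      have e6 : Real.exp y ≤ 1 + y * Real.exp y := by
        have h := Real.add_one_le_exp (-y)
        have h' := mul_le_mul_of_nonneg_right h (Real.exp_pos y).le
        rw [← Real.exp_add, neg_add_cancel, Real.exp_zero] at h'
        linarith
      have e7 : Real.exp (-(m * Q t)) * Real.exp y ≤ Real.exp (-(m * (c / 2)) * ‖t‖ ^ 2) := by
        rw [← Real.exp_add]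
        refine Real.exp_le_exp.2 ?_
        have e8 : y ≤ m * (c / 2) * ‖t‖ ^ 2 := by
          calc y = m * (D * ‖t‖ ^ 2) * ‖t‖ ^ 2 := by rw [hy]; ring
            _ ≤ m * (c / 2) * ‖t‖ ^ 2 := by gcongr
        have e9 : m * (c * ‖t‖ ^ 2) ≤ m * Q t := by gcongr; exact hQ t
        linarith
      have e10 : 0 ≤ Real.exp (-η * (m - 1)) * cosTransform τ t :=
        mul_nonneg (Real.exp_pos _).le (hW t)
      calc cosTransform τ t ^ m ≤ Real.exp (-(m * Q t)) * Real.exp y := e5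
        _ ≤ Real.exp (-(m * Q t)) * (1 + y * Real.exp y) := by gcongr
        _ = Real.exp (-(m * Q t)) + y * (Real.exp (-(m * Q t)) * Real.exp y) := by ring
        _ ≤ Real.exp (-(m * Q t)) + y * Real.exp (-(m * (c / 2)) * ‖t‖ ^ 2) := by gcongr
        _ = Real.exp (-(m * Q t)) + m * D * (‖t‖ ^ 4 * Real.exp (-(m * (c / 2)) * ‖t‖ ^ 2)) := by
            rw [hy]; ring
        _ ≤ _ := le_add_of_nonneg_right e10
    · have e1 := H₂ τ hτ h2 hB2 hW hWi hI t ht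
      have e2 : cosTransform τ t ^ m ≤ Real.exp (-η * (m - 1)) * cosTransform τ t := by
        have : cosTransform τ t ^ m = cosTransform τ t ^ (m - 1) * cosTransform τ t := by
          rcases (hW t).eq_or_lt with h0 | h0
          · rw [← h0, mul_zero, Real.zero_rpow hm0.ne']
          · rw [← Real.rpow_add_one h0.ne', sub_add_cancel]
        rw [this]
        refine mul_le_mul_of_nonneg_right ?_ (hW t)
        refine (Real.rpow_le_rpow (hW t) e1 (by linarith)).trans ?_
        rw [← Real.exp_mul]
      have e3 : 0 ≤ Real.exp (-(m * Q t)) +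
          m * D * (‖t‖ ^ 4 * Real.exp (-(m * (c / 2)) * ‖t‖ ^ 2)) := by positivity
      linarith
  have i1 : Integrable fun t => Real.exp (-(m * Q t)) := by
    refine (integrable_exp_neg_mul_sq_norm (E := E) (b := m * c) (by positivity)).mono
      (by fun_prop) (Eventually.of_forall fun t => ?_)
    rw [Real.norm_of_nonneg (by positivity), Real.norm_of_nonneg (by positivity)]
    refine Real.exp_le_exp.2 ?_
    have : m * (c * ‖t‖ ^ 2) ≤ m * Q t := by gcongr; exact hQ t
    linarith
  have i2 := (integrable_norm_pow_four_mul_gaussian (E := E) (b := m * (c / 2))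
    (by positivity)).const_mul (m * D)
  have i3 := hWi.const_mul (Real.exp (-η * (m - 1)))
  have i4 : Integrable fun t => Real.exp (-(m * Q t)) +
      m * D * (‖t‖ ^ 4 * Real.exp (-(m * (c / 2)) * ‖t‖ ^ 2)) := i1.add i2
  have hle : ∫ t, cosTransform τ t ^ m ≤ (∫ t, Real.exp (-(m * Q t))) +
      m * D * (∫ t : E, ‖t‖ ^ 4 * Real.exp (-(m * (c / 2)) * ‖t‖ ^ 2)) +
      Real.exp (-η * (m - 1)) * ∫ t, cosTransform τ t := by
    rw [← integral_const_mul, ← integral_const_mul, ← integral_add i1 i2,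
      ← integral_add i4 i3]
    exact integral_mono_of_nonneg (Eventually.of_forall fun t => Real.rpow_nonneg (hW t) m)
      (i4.add i3) (Eventually.of_forall hpt)
  have s1 : m ^ ((finrank ℝ E : ℝ) / 2) * ∫ t, Real.exp (-(m * Q t)) =
      ∫ t, Real.exp (-(Q t)) := by
    rw [← integral_comp_sqrt_smul (fun t => Real.exp (-(Q t))) hm0]
    simp_rw [hQdef, halfSecondMoment_smul τ, Real.sq_sqrt hm0.le]
  have s2 : m ^ ((finrank ℝ E : ℝ) / 2) *
      (m * D * (∫ t : E, ‖t‖ ^ 4 * Real.exp (-(m * (c / 2)) * ‖t‖ ^ 2))) = D * G / m := by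
    rw [hG, ← integral_comp_sqrt_smul (fun s : E => ‖s‖ ^ 4 * Real.exp (-(c / 2) * ‖s‖ ^ 2)) hm0]
    have : ∀ t : E, ‖Real.sqrt m • t‖ ^ 4 * Real.exp (-(c / 2) * ‖Real.sqrt m • t‖ ^ 2) =
        m ^ 2 * (‖t‖ ^ 4 * Real.exp (-(m * (c / 2)) * ‖t‖ ^ 2)) := by
      intro t
      have e : Real.sqrt m ^ 4 = m ^ 2 := by
        rw [show 4 = 2 * 2 by norm_num, pow_mul, Real.sq_sqrt hm0.le]
      rw [norm_smul, Real.norm_of_nonneg (Real.sqrt_nonneg m), mul_pow, mul_pow, e,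
        Real.sq_sqrt hm0.le, show -(c / 2) * (m * ‖t‖ ^ 2) = -(m * (c / 2)) * ‖t‖ ^ 2 by ring]
      ring
    simp_rw [this, integral_const_mul]
    generalize (∫ t : E, ‖t‖ ^ 4 * Real.exp (-(m * (c / 2)) * ‖t‖ ^ 2)) = J
    field_simp
  have s3 : Real.exp (-η * (m - 1)) = Real.exp (-η * m) * Real.exp η := by
    rw [← Real.exp_add]; ring_nf
  calc m ^ ((finrank ℝ E : ℝ) / 2) * ∫ t, cosTransform τ t ^ m
      ≤ m ^ ((finrank ℝ E : ℝ) / 2) * ((∫ t, Real.exp (-(m * Q t))) +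
        m * D * (∫ t : E, ‖t‖ ^ 4 * Real.exp (-(m * (c / 2)) * ‖t‖ ^ 2)) +
        Real.exp (-η * (m - 1)) * I) := by
        gcongr
        exact hle.trans (by gcongr)
    _ = _ := by
        rw [mul_add, mul_add, s1, s2, s3]
        ring

end CosTransform

/-! ### Differentiation of exponential integrals -/

section LaplaceTransform

open Module
open scoped ENNReal RealInnerProductSpace

variable {E : Type*} [NormedAddCommGroup E] [InnerProductSpace ℝ E] [FiniteDimensional ℝ E]
  [MeasurableSpace E] [BorelSpace E] {ν : Measure E}

theorem integrable_exp_mul_norm [IsFiniteMeasure ν]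
    (H : ∀ t : E, Integrable (fun x => Real.exp ⟪t, x⟫) ν) (a : ℝ) :
    Integrable (fun x => Real.exp (a * ‖x‖)) ν := by
  let e := stdOrthonormalBasis ℝ E
  set D : ℝ := finrank ℝ E * |a| with hD
  have hsum : Integrable (fun x => 1 + ∑ i, (Real.exp ⟪D • e i, x⟫ + Real.exp ⟪(-D) • e i, x⟫)) ν :=
    (integrable_const 1).add (integrable_finsetSum _ fun i _ => (H _).add (H _))
  refine hsum.mono (by fun_prop) (Eventually.of_forall fun x => ?_)
  have hpos : 0 ≤ ∑ i, (Real.exp ⟪D • e i, x⟫ + Real.exp ⟪(-D) • e i, x⟫) := by positivity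
  rw [Real.norm_of_nonneg (Real.exp_pos _).le, Real.norm_of_nonneg (by positivity)]
  have hx : ‖x‖ ≤ ∑ i, |⟪e i, x⟫| := by
    conv_lhs => rw [← e.sum_repr' x]
    refine (norm_sum_le _ _).trans (Finset.sum_le_sum fun i _ => ?_)
    rw [norm_smul, e.norm_eq_one, mul_one, Real.norm_eq_abs]
  rcases isEmpty_or_nonempty (Fin (finrank ℝ E)) with h | h
  · simp only [Finset.univ_eq_empty, Finset.sum_empty] at hx
    rw [le_antisymm hx (norm_nonneg x), mul_zero, Real.exp_zero]
    linarith
  · obtain ⟨i, -, hi⟩ := Finset.exists_max_image Finset.univ (fun i => |⟪e i, x⟫|)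
      Finset.univ_nonempty
    have h1 : a * ‖x‖ ≤ D * |⟪e i, x⟫| := by
      calc a * ‖x‖ ≤ |a| * ∑ i, |⟪e i, x⟫| :=
            mul_le_mul (le_abs_self a) hx (norm_nonneg _) (abs_nonneg _)
        _ ≤ |a| * (finrank ℝ E * |⟪e i, x⟫|) := by
            refine mul_le_mul_of_nonneg_left ?_ (abs_nonneg _)
            refine (Finset.sum_le_card_nsmul _ _ _ hi).trans ?_
            simp
        _ = D * |⟪e i, x⟫| := by rw [hD]; ring
    have h2 : Real.exp (D * |⟪e i, x⟫|) ≤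
        Real.exp ⟪D • e i, x⟫ + Real.exp ⟪(-D) • e i, x⟫ := by
      rw [real_inner_smul_left, real_inner_smul_left]
      rcases abs_cases ⟪e i, x⟫ with ⟨h3, -⟩ | ⟨h3, -⟩ <;> rw [h3]
      · linarith [Real.exp_pos (-D * ⟪e i, x⟫)]
      · rw [mul_neg, ← neg_mul]
        linarith [Real.exp_pos (D * ⟪e i, x⟫)]
    have h3 := Finset.single_le_sum (f := fun i =>
      Real.exp ⟪D • e i, x⟫ + Real.exp ⟪(-D) • e i, x⟫) (fun j _ => by positivity)
      (Finset.mem_univ i)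
    have h4 := Real.exp_le_exp.2 h1
    linarith

theorem integrable_norm_pow_mul_exp [IsFiniteMeasure ν]
    (H : ∀ t : E, Integrable (fun x => Real.exp ⟪t, x⟫) ν) (k : ℕ) (a : ℝ) :
    Integrable (fun x => ‖x‖ ^ k * Real.exp (a * ‖x‖)) ν := by
  refine ((integrable_exp_mul_norm H (a + 1)).const_mul (k.factorial : ℝ)).mono (by fun_prop)
    (Eventually.of_forall fun x => ?_)
  rw [Real.norm_of_nonneg (by positivity), Real.norm_of_nonneg (by positivity), add_mul, one_mul,
    Real.exp_add, mul_comm (Real.exp (a * ‖x‖)), ← mul_assoc]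
  refine mul_le_mul_of_nonneg_right ?_ (Real.exp_pos _).le
  have := Real.pow_div_factorial_le_exp ‖x‖ (norm_nonneg x) k
  rwa [div_le_iff₀' (by positivity)] at this

omit [FiniteDimensional ℝ E] [MeasurableSpace E] [BorelSpace E] in
theorem exp_inner_le_exp_mul_norm {t x : E} {R : ℝ} (ht : ‖t‖ ≤ R) :
    Real.exp ⟪t, x⟫ ≤ Real.exp (R * ‖x‖) :=
  Real.exp_le_exp.2 ((real_inner_le_norm t x).trans
    (mul_le_mul_of_nonneg_right ht (norm_nonneg x)))

/-- Differentiation of an exponential integral under the integral sign. -/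
theorem exists_hasFDerivAt_integral_mul_exp {g : E → ℝ} (hg : AEStronglyMeasurable g ν)
    (h : ∀ (k : ℕ) (a : ℝ), Integrable (fun x => |g x| * (‖x‖ ^ k * Real.exp (a * ‖x‖))) ν)
    (t : E) :
    ∃ F' : E →L[ℝ] ℝ, HasFDerivAt (fun s => ∫ x, g x * Real.exp ⟪s, x⟫ ∂ν) F' t ∧
      ∀ v, F' v = ∫ x, g x * ⟪v, x⟫ * Real.exp ⟪t, x⟫ ∂ν := by
  have hball : ∀ s ∈ Metric.ball t 1, ‖s‖ ≤ ‖t‖ + 1 := by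
    intro s hs
    have h1 := norm_sub_norm_le s t
    have h2 := mem_ball_iff_norm.1 hs
    linarith
  have hmeas : ∀ s : E, AEStronglyMeasurable (fun x => g x * Real.exp ⟪s, x⟫) ν := fun s =>
    hg.mul (by fun_prop)
  have hF : ∀ s x : E, ‖(g x * Real.exp ⟪s, x⟫) • innerSL ℝ x‖ =
      |g x| * Real.exp ⟪s, x⟫ * ‖x‖ := by
    intro s x
    rw [norm_smul, norm_mul, innerSL_apply_norm, Real.norm_eq_abs, Real.norm_eq_abs, Real.abs_exp]
  have hbound : ∀ s ∈ Metric.ball t 1, ∀ x : E, ‖(g x * Real.exp ⟪s, x⟫) • innerSL ℝ x‖ ≤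
      |g x| * (‖x‖ ^ 1 * Real.exp ((‖t‖ + 1) * ‖x‖)) := by
    intro s hs x
    rw [hF, pow_one, mul_assoc, mul_comm (Real.exp _)]
    have := exp_inner_le_exp_mul_norm (x := x) (hball s hs)
    gcongr
  have hm' : AEStronglyMeasurable (fun x => (g x * Real.exp ⟪t, x⟫) • innerSL ℝ x) ν :=
    (hmeas t).smul (innerSL ℝ).continuous.aestronglyMeasurable
  have hint : Integrable (fun x => (g x * Real.exp ⟪t, x⟫) • innerSL ℝ x) ν :=
    (h 1 (‖t‖ + 1)).mono' hm' (Eventually.of_forall (hbound t (Metric.mem_ball_self one_pos)))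
  refine ⟨∫ x, (g x * Real.exp ⟪t, x⟫) • innerSL ℝ x ∂ν, ?_, fun v => ?_⟩
  · refine hasFDerivAt_integral_of_dominated_of_fderiv_le (Metric.ball_mem_nhds t one_pos)
      (F := fun s x => g x * Real.exp ⟪s, x⟫)
      (F' := fun s x => (g x * Real.exp ⟪s, x⟫) • innerSL ℝ x)
      (bound := fun x => |g x| * (‖x‖ ^ 1 * Real.exp ((‖t‖ + 1) * ‖x‖)))
      (Eventually.of_forall hmeas) ?_ hm'
      (Eventually.of_forall fun x s hs => hbound s hs x) (h 1 _)
      (Eventually.of_forall fun x s _ => ?_)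
    · refine (h 0 ‖t‖).mono' (hmeas t) (Eventually.of_forall fun x => ?_)
      rw [norm_mul, Real.norm_eq_abs, Real.norm_eq_abs, Real.abs_exp, pow_zero, one_mul]
      have := exp_inner_le_exp_mul_norm (x := x) (le_refl ‖t‖)
      gcongr
    · have h1 : HasFDerivAt (fun s : E => ⟪s, x⟫) (innerSL ℝ x) s := by
        have := (innerSL ℝ x).hasFDerivAt (x := s)
        simpa [innerSL_apply_apply, real_inner_comm] using this
      have h2 := (h1.exp).const_mul (g x)
      rwa [smul_smul] at h2
  · rw [ContinuousLinearMap.integral_apply hint]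
    congr 1 with x
    simp only [_root_.smul_apply, innerSL_apply_apply, smul_eq_mul,
      real_inner_comm v x]
    ring

end LaplaceTransform

/-! ### Exponential tilting and the derivatives of the log-Laplace transform -/

section Hessian

open Module
open scoped ENNReal RealInnerProductSpace Matrix

variable {d : ℕ} {ν : Measure (EuclideanSpace ℝ (Fin d))} [IsProbabilityMeasure ν]

/-- The exponentially tilted measure with density proportional to `exp ⟨h, x⟩`. -/
def expTilt (ν : Measure (EuclideanSpace ℝ (Fin d))) (h : EuclideanSpace ℝ (Fin d)) :
    Measure (EuclideanSpace ℝ (Fin d)) :=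
  ν.tilted fun x => ⟪h, x⟫

theorem isProbabilityMeasure_expTilt {h : EuclideanSpace ℝ (Fin d)}
    (H : Integrable (fun x => Real.exp ⟪h, x⟫) ν) : IsProbabilityMeasure (expTilt ν h) :=
  isProbabilityMeasure_tilted H

omit [IsProbabilityMeasure ν] in
theorem integral_expTilt (h : EuclideanSpace ℝ (Fin d)) (f : EuclideanSpace ℝ (Fin d) → ℝ) :
    ∫ x, f x ∂(expTilt ν h) =
      (∫ x, f x * Real.exp ⟪h, x⟫ ∂ν) / ∫ x, Real.exp ⟪h, x⟫ ∂ν := by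
  rw [expTilt, integral_tilted, ← integral_div]
  congr 1 with x
  rw [smul_eq_mul]
  ring

variable (H : ∀ t : EuclideanSpace ℝ (Fin d), Integrable (fun x => Real.exp ⟪t, x⟫) ν)
include H

theorem integrable_norm_pow_expTilt (h : EuclideanSpace ℝ (Fin d)) (k : ℕ) :
    Integrable (fun x => ‖x‖ ^ k) (expTilt ν h) := by
  rw [expTilt, integrable_tilted_iff (H h)]
  refine (integrable_norm_pow_mul_exp H k ‖h‖).mono' (by fun_prop)
    (Eventually.of_forall fun x => ?_)
  rw [smul_eq_mul, Real.norm_of_nonneg (by positivity), mul_comm]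
  have := exp_inner_le_exp_mul_norm (x := x) (le_refl ‖h‖)
  gcongr

theorem integral_exp_inner_pos (t : EuclideanSpace ℝ (Fin d)) :
    0 < ∫ x, Real.exp ⟪t, x⟫ ∂ν :=
  integral_exp_pos (H t)

theorem exp_logLaplace_id (t : EuclideanSpace ℝ (Fin d)) :
    Real.exp (logLaplace ν id t) = ∫ x, Real.exp ⟪t, x⟫ ∂ν :=
  Real.exp_log (integral_exp_inner_pos H t)

theorem exists_hasFDerivAt_laplace (t : EuclideanSpace ℝ (Fin d)) :
    ∃ F' : EuclideanSpace ℝ (Fin d) →L[ℝ] ℝ,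
      HasFDerivAt (fun s => ∫ x, Real.exp ⟪s, x⟫ ∂ν) F' t ∧
      ∀ v, F' v = ∫ x, ⟪v, x⟫ * Real.exp ⟪t, x⟫ ∂ν := by
  have := exists_hasFDerivAt_integral_mul_exp (ν := ν) (g := fun _ => 1) (by fun_prop)
    (fun k a => by simpa using integrable_norm_pow_mul_exp H k a) t
  simpa using this

theorem exists_hasFDerivAt_inner_laplace (v t : EuclideanSpace ℝ (Fin d)) :
    ∃ F' : EuclideanSpace ℝ (Fin d) →L[ℝ] ℝ,
      HasFDerivAt (fun s => ∫ x, ⟪v, x⟫ * Real.exp ⟪s, x⟫ ∂ν) F' t ∧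
      ∀ w, F' w = ∫ x, ⟪v, x⟫ * ⟪w, x⟫ * Real.exp ⟪t, x⟫ ∂ν := by
  refine exists_hasFDerivAt_integral_mul_exp (ν := ν) (g := fun x => ⟪v, x⟫) (by fun_prop)
    (fun k a => ?_) t
  refine ((integrable_norm_pow_mul_exp H (k + 1) a).const_mul ‖v‖).mono' (by fun_prop)
    (Eventually.of_forall fun x => ?_)
  rw [Real.norm_of_nonneg (by positivity), pow_succ']
  calc |⟪v, x⟫| * (‖x‖ ^ k * Real.exp (a * ‖x‖))
      ≤ ‖v‖ * ‖x‖ * (‖x‖ ^ k * Real.exp (a * ‖x‖)) := by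
        gcongr; exact abs_real_inner_le_norm v x
    _ = _ := by ring

theorem continuous_integral_inner_mul_inner_mul_exp (v w : EuclideanSpace ℝ (Fin d)) :
    Continuous fun s => ∫ x, ⟪v, x⟫ * ⟪w, x⟫ * Real.exp ⟪s, x⟫ ∂ν := by
  refine continuous_iff_continuousAt.2 fun t => ?_
  obtain ⟨F', hF', -⟩ := exists_hasFDerivAt_integral_mul_exp (ν := ν)
    (g := fun x => ⟪v, x⟫ * ⟪w, x⟫) (by fun_prop) (fun k a => by
      refine ((integrable_norm_pow_mul_exp H (k + 2) a).const_mul (‖v‖ * ‖w‖)).mono' (by fun_prop)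
        (Eventually.of_forall fun x => ?_)
      rw [Real.norm_of_nonneg (by positivity), abs_mul]
      calc |⟪v, x⟫| * |⟪w, x⟫| * (‖x‖ ^ k * Real.exp (a * ‖x‖))
          ≤ ‖v‖ * ‖x‖ * (‖w‖ * ‖x‖) * (‖x‖ ^ k * Real.exp (a * ‖x‖)) := by
            gcongr
            · exact abs_real_inner_le_norm v x
            · exact abs_real_inner_le_norm w x
        _ = _ := by ring) t
  exact hF'.continuousAt

theorem hasFDerivAt_logLaplace (t : EuclideanSpace ℝ (Fin d)) :
    ∃ F' : EuclideanSpace ℝ (Fin d) →L[ℝ] ℝ, HasFDerivAt (logLaplace ν id) F' t ∧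
      ∀ v, F' v = (∫ x, ⟪v, x⟫ * Real.exp ⟪t, x⟫ ∂ν) / ∫ x, Real.exp ⟪t, x⟫ ∂ν := by
  obtain ⟨F', hF', h⟩ := exists_hasFDerivAt_laplace H t
  refine ⟨_, hF'.log (integral_exp_inner_pos H t).ne', fun v => ?_⟩
  rw [_root_.smul_apply, h, smul_eq_mul, div_eq_inv_mul]

theorem continuous_logLaplace : Continuous (logLaplace ν id) :=
  continuous_iff_continuousAt.2 fun t =>
    let ⟨_, hF', _⟩ := hasFDerivAt_logLaplace H t
    hF'.continuousAt

theorem fderiv_logLaplace (v : EuclideanSpace ℝ (Fin d)) :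
    (fun t => fderiv ℝ (logLaplace ν id) t v) =
      fun t => (∫ x, ⟪v, x⟫ * Real.exp ⟪t, x⟫ ∂ν) / ∫ x, Real.exp ⟪t, x⟫ ∂ν := by
  ext t
  obtain ⟨F', hF', h⟩ := hasFDerivAt_logLaplace H t
  rw [hF'.fderiv, h]

theorem exists_hasFDerivAt_fderiv_logLaplace (v t : EuclideanSpace ℝ (Fin d)) :
    ∃ F' : EuclideanSpace ℝ (Fin d) →L[ℝ] ℝ,
      HasFDerivAt (fun s => fderiv ℝ (logLaplace ν id) s v) F' t ∧
      ∀ w, F' w = (∫ x, ⟪v, x⟫ * ⟪w, x⟫ * Real.exp ⟪t, x⟫ ∂ν) / (∫ x, Real.exp ⟪t, x⟫ ∂ν) -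
        (∫ x, ⟪v, x⟫ * Real.exp ⟪t, x⟫ ∂ν) / (∫ x, Real.exp ⟪t, x⟫ ∂ν) *
        ((∫ x, ⟪w, x⟫ * Real.exp ⟪t, x⟫ ∂ν) / ∫ x, Real.exp ⟪t, x⟫ ∂ν) := by
  rw [fderiv_logLaplace H v]
  obtain ⟨N', hN', hN⟩ := exists_hasFDerivAt_inner_laplace H v t
  obtain ⟨L', hL', hL⟩ := exists_hasFDerivAt_laplace H t
  have hpos := integral_exp_inner_pos H t
  simp_rw [div_eq_mul_inv]
  refine ⟨_, hN'.mul ((hasDerivAt_inv hpos.ne').comp_hasFDerivAt t hL'), fun w => ?_⟩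
  simp only [_root_.smul_apply, _root_.add_apply, hN, hL, smul_eq_mul]
  field_simp
  ring

/-- The Hessian of the log-Laplace transform is the covariance matrix of the tilted measure. -/
theorem hessianMatrix_logLaplace_apply (t : EuclideanSpace ℝ (Fin d)) (i j : Fin d) :
    hessianMatrix (logLaplace ν id) t i j =
      (∫ x, x i * x j ∂(expTilt ν t)) - (∫ x, x i ∂(expTilt ν t)) * ∫ x, x j ∂(expTilt ν t) := by
  obtain ⟨F', hF', h⟩ := exists_hasFDerivAt_fderiv_logLaplace H (EuclideanSpace.single j 1) t
  rw [hessianMatrix, Matrix.of_apply, hF'.fderiv, h, integral_expTilt, integral_expTilt,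
    integral_expTilt]
  simp only [EuclideanSpace.inner_single_left, map_one, one_mul]
  have e : ∀ x : EuclideanSpace ℝ (Fin d), x j * x i = x i * x j := fun x => mul_comm _ _
  simp only [e]
  rw [mul_comm (_ / _)]

theorem continuous_hessianMatrix_logLaplace : Continuous (hessianMatrix (logLaplace ν id)) := by
  refine continuous_matrix fun i j => ?_
  have hL : Continuous fun t => ∫ x, Real.exp ⟪t, x⟫ ∂ν :=
    continuous_iff_continuousAt.2 fun t =>
      let ⟨_, hF', _⟩ := exists_hasFDerivAt_laplace H t
      hF'.continuousAt
  have hN : ∀ v, Continuous fun t => ∫ x, ⟪v, x⟫ * Real.exp ⟪t, x⟫ ∂ν := fun v =>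
    continuous_iff_continuousAt.2 fun t =>
      let ⟨_, hF', _⟩ := exists_hasFDerivAt_inner_laplace H v t
      hF'.continuousAt
  have hne : ∀ t, ∫ x, Real.exp ⟪t, x⟫ ∂ν ≠ 0 := fun t => (integral_exp_inner_pos H t).ne'
  have e : (fun t => hessianMatrix (logLaplace ν id) t i j) = fun t =>
      (∫ x, ⟪EuclideanSpace.single j 1, x⟫ * ⟪EuclideanSpace.single i 1, x⟫ *
        Real.exp ⟪t, x⟫ ∂ν) / (∫ x, Real.exp ⟪t, x⟫ ∂ν) -
        (∫ x, ⟪EuclideanSpace.single j 1, x⟫ * Real.exp ⟪t, x⟫ ∂ν) /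
          (∫ x, Real.exp ⟪t, x⟫ ∂ν) *
        ((∫ x, ⟪EuclideanSpace.single i 1, x⟫ * Real.exp ⟪t, x⟫ ∂ν) /
          ∫ x, Real.exp ⟪t, x⟫ ∂ν) := by
    ext t
    obtain ⟨F', hF', h⟩ := exists_hasFDerivAt_fderiv_logLaplace H (EuclideanSpace.single j 1) t
    rw [hessianMatrix, Matrix.of_apply, hF'.fderiv, h]
  rw [e]
  exact ((continuous_integral_inner_mul_inner_mul_exp H _ _).div hL hne).sub
    (((hN _).div hL hne).mul ((hN _).div hL hne))

theorem hessianMatrix_sq_norm_sub_logLaplace (t : EuclideanSpace ℝ (Fin d)) :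
    hessianMatrix (fun s => ‖s‖ ^ 2 / 2 - logLaplace ν id s) t =
      1 - hessianMatrix (logLaplace ν id) t := by
  ext i j
  have e : (fun s => fderiv ℝ (fun s => ‖s‖ ^ 2 / 2 - logLaplace ν id s) s
      (EuclideanSpace.single j 1)) =
      fun s => ⟪EuclideanSpace.single j 1, s⟫ -
        fderiv ℝ (logLaplace ν id) s (EuclideanSpace.single j 1) := by
    ext s
    obtain ⟨F', hF', -⟩ := hasFDerivAt_logLaplace H s
    have h1 : HasFDerivAt (fun s : EuclideanSpace ℝ (Fin d) => ‖s‖ ^ 2 / 2)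
        (innerSL ℝ s) s := by
      have := (hasStrictFDerivAt_norm_sq s).hasFDerivAt.const_mul (1 / 2 : ℝ)
      convert! this using 1
      · ext s; ring
      · ext v; simp
    rw [(h1.fun_sub hF').fderiv, hF'.fderiv, _root_.sub_apply, innerSL_apply_apply,
      real_inner_comm]
  obtain ⟨F', hF', h⟩ := exists_hasFDerivAt_fderiv_logLaplace H (EuclideanSpace.single j 1) t
  have h2 : HasFDerivAt (fun s : EuclideanSpace ℝ (Fin d) => ⟪EuclideanSpace.single j (1 : ℝ), s⟫)
      (innerSL ℝ (EuclideanSpace.single j 1)) t := (innerSL ℝ (EuclideanSpace.single j 1)).hasFDerivAt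
  rw [hessianMatrix, Matrix.of_apply, e, (h2.fun_sub hF').fderiv, Matrix.sub_apply, hessianMatrix,
    Matrix.of_apply, hF'.fderiv, _root_.sub_apply, innerSL_apply_apply]
  simp [Matrix.one_apply, EuclideanSpace.inner_single_left, eq_comm]

end Hessian

/-! ### Gaussian integrals of quadratic forms -/

section GaussianDeterminant

open Module
open scoped ENNReal RealInnerProductSpace Matrix MatrixOrder

variable {d : ℕ}

theorem integral_exp_neg_dotProduct_mulVec {M : Matrix (Fin d) (Fin d) ℝ} (hM : M.PosDef) :
    ∫ t : EuclideanSpace ℝ (Fin d), Real.exp (-(t.ofLp ⬝ᵥ (M *ᵥ t.ofLp))) =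
      Real.pi ^ ((d : ℝ) / 2) / Real.sqrt M.det := by
  obtain ⟨B, hB⟩ := CStarAlgebra.nonneg_iff_eq_star_mul_self.mp hM.posSemidef.nonneg
  have hdet : M.det = B.det ^ 2 := by
    rw [hB, Matrix.det_mul, Matrix.star_eq_conjTranspose, Matrix.det_conjTranspose, star_trivial, sq]
  have hdet0 : B.det ≠ 0 := by
    have := hM.det_pos
    rw [hdet] at this
    exact fun h => by simp [h] at this
  let f : EuclideanSpace ℝ (Fin d) →ₗ[ℝ] EuclideanSpace ℝ (Fin d) := Matrix.toEuclideanLin B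
  have hf : LinearMap.det f = B.det := LinearMap.det_toLpLin 2 B
  have hquad : ∀ t : EuclideanSpace ℝ (Fin d), t.ofLp ⬝ᵥ (M *ᵥ t.ofLp) = ‖f t‖ ^ 2 := by
    intro t
    rw [EuclideanSpace.real_norm_sq_eq, hB, Matrix.star_eq_conjTranspose, ← Matrix.mulVec_mulVec,
      Matrix.conjTranspose_eq_transpose_of_trivial, Matrix.dotProduct_mulVec,
      Matrix.vecMul_transpose, dotProduct]
    simp only [f, Matrix.ofLp_toLpLin, Matrix.toLin'_apply, sq]
  simp_rw [hquad]
  have hmap := Measure.map_linearMap_addHaar_eq_smul_addHaar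
    (volume : Measure (EuclideanSpace ℝ (Fin d))) (f := f) (by rwa [hf])
  have h1 : ∫ t, Real.exp (-‖f t‖ ^ 2) =
      ∫ x, Real.exp (-‖x‖ ^ 2) ∂(Measure.map f volume) :=
    (integral_map (f := fun x => Real.exp (-‖x‖ ^ 2))
      (LinearMap.continuous_of_finiteDimensional f).aemeasurable (by fun_prop)).symm
  have h2 := GaussianFourier.integral_rexp_neg_mul_sq_norm (V := EuclideanSpace ℝ (Fin d)) one_pos
  simp only [neg_mul, one_mul, div_one, finrank_euclideanSpace_fin] at h2
  rw [h1, hmap, integral_smul_measure, h2, hf, hdet, Real.sqrt_sq_eq_abs,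
    ENNReal.toReal_ofReal (abs_nonneg _), abs_inv, smul_eq_mul, inv_mul_eq_div]

theorem posDef_of_le_dotProduct_mulVec {M : Matrix (Fin d) (Fin d) ℝ} (hM : M.IsHermitian) {c : ℝ}
    (hc : 0 < c)
    (h : ∀ t : EuclideanSpace ℝ (Fin d), c * ‖t‖ ^ 2 ≤ t.ofLp ⬝ᵥ (M *ᵥ t.ofLp)) : M.PosDef := by
  refine Matrix.posDef_iff_dotProduct_mulVec.2 ⟨hM, fun x hx => ?_⟩
  have h1 := h (WithLp.toLp 2 x)
  have h2 : 0 < ‖WithLp.toLp 2 x‖ := norm_pos_iff.2 (by simpa using hx)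
  rw [star_trivial]
  exact lt_of_lt_of_le (by positivity) h1

end GaussianDeterminant

/-! ### Moments of the symmetrization -/

section SymmetrizedTilt

open Module
open scoped ENNReal RealInnerProductSpace Matrix

variable {d : ℕ}

theorem integrable_coord_mul_coord {ρ : Measure (EuclideanSpace ℝ (Fin d))}
    (h2 : Integrable (fun x => ‖x‖ ^ 2) ρ) (i j : Fin d) : Integrable (fun x => x i * x j) ρ := by
  refine h2.mono' (by fun_prop) (Eventually.of_forall fun x => ?_)
  rw [norm_mul, sq]
  exact mul_le_mul (PiLp.norm_apply_le x i) (PiLp.norm_apply_le x j) (norm_nonneg _) (norm_nonneg _)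

theorem integrable_coord {ρ : Measure (EuclideanSpace ℝ (Fin d))}
    (h1 : Integrable (fun x => ‖x‖) ρ) (i : Fin d) : Integrable (fun x => x i) ρ :=
  h1.mono' (by fun_prop) (Eventually.of_forall fun x => PiLp.norm_apply_le x i)

/-- The second moments of the symmetrization are given by the covariance matrix. -/
theorem halfSecondMoment_symmetrization {ρ : Measure (EuclideanSpace ℝ (Fin d))}
    [IsProbabilityMeasure ρ] (h1 : Integrable (fun x => ‖x‖) ρ)
    (h2 : Integrable (fun x => ‖x‖ ^ 2) ρ) {M : Matrix (Fin d) (Fin d) ℝ}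
    (hM : ∀ i j, M i j = (∫ x, x i * x j ∂ρ) - (∫ x, x i ∂ρ) * ∫ x, x j ∂ρ)
    (t : EuclideanSpace ℝ (Fin d)) :
    halfSecondMoment (symmetrization ρ) t = t.ofLp ⬝ᵥ (M *ᵥ t.ofLp) := by
  have hi1 : Integrable (fun x => ⟪x, t⟫) ρ := by
    simpa using integrable_inner_pow (k := 1) (by simpa using h1) t
  have hi2 := integrable_inner_pow (k := 2) h2 t
  have e1 : ∫ x, ⟪x, t⟫ ∂ρ = ∑ i, t i * ∫ x, x i ∂ρ := by
    simp_rw [PiLp.inner_apply, RCLike.inner_apply, conj_trivial]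
    rw [integral_finsetSum _ fun i _ => (integrable_coord h1 i).const_mul _]
    simp_rw [integral_const_mul]
  have e2 : ∫ x, ⟪x, t⟫ ^ 2 ∂ρ = ∑ i, ∑ j, t i * t j * ∫ x, x i * x j ∂ρ := by
    have : ∀ x : EuclideanSpace ℝ (Fin d), ⟪x, t⟫ ^ 2 = ∑ i, ∑ j, t i * t j * (x i * x j) := by
      intro x
      simp_rw [PiLp.inner_apply, RCLike.inner_apply, conj_trivial, sq, Finset.sum_mul_sum]
      exact Finset.sum_congr rfl fun i _ => Finset.sum_congr rfl fun j _ => by ring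
    simp_rw [this]
    have hij : ∀ i j, Integrable (fun x : EuclideanSpace ℝ (Fin d) => t i * t j * (x i * x j)) ρ :=
      fun i j => (integrable_coord_mul_coord h2 i j).const_mul _
    rw [integral_finsetSum _ fun i _ => integrable_finsetSum _ fun j _ => hij i j]
    refine Finset.sum_congr rfl fun i _ => ?_
    rw [integral_finsetSum _ fun j _ => hij i j]
    simp_rw [integral_const_mul]
  have e3 : halfSecondMoment (symmetrization ρ) t =
      (∫ x, ⟪x, t⟫ ^ 2 ∂ρ) - (∫ x, ⟪x, t⟫ ∂ρ) ^ 2 := by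
    rw [halfSecondMoment, symmetrization, integral_map (by fun_prop) (by fun_prop)]
    have e : ∀ p : EuclideanSpace ℝ (Fin d) × EuclideanSpace ℝ (Fin d),
        ⟪p.1 - p.2, t⟫ ^ 2 / 2 =
          ⟪p.1, t⟫ ^ 2 / 2 * 1 - ⟪p.1, t⟫ * ⟪p.2, t⟫ + 1 * (⟪p.2, t⟫ ^ 2 / 2) := by
      intro p
      rw [inner_sub_left]
      ring
    simp_rw [e]
    have j1 : Integrable (fun p : EuclideanSpace ℝ (Fin d) × EuclideanSpace ℝ (Fin d) =>
        ⟪p.1, t⟫ ^ 2 / 2 * (1 : ℝ)) (ρ.prod ρ) := (hi2.div_const 2).mul_prod (integrable_const 1)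
    have j2 : Integrable (fun p : EuclideanSpace ℝ (Fin d) × EuclideanSpace ℝ (Fin d) =>
        ⟪p.1, t⟫ * ⟪p.2, t⟫) (ρ.prod ρ) := hi1.mul_prod hi1
    have j3 : Integrable (fun p : EuclideanSpace ℝ (Fin d) × EuclideanSpace ℝ (Fin d) =>
        (1 : ℝ) * (⟪p.2, t⟫ ^ 2 / 2)) (ρ.prod ρ) :=
      (integrable_const (1 : ℝ)).mul_prod (hi2.div_const 2)
    have j4 : Integrable (fun p : EuclideanSpace ℝ (Fin d) × EuclideanSpace ℝ (Fin d) =>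
        ⟪p.1, t⟫ ^ 2 / 2 * (1 : ℝ) - ⟪p.1, t⟫ * ⟪p.2, t⟫) (ρ.prod ρ) := j1.sub j2
    rw [integral_add j4 j3, integral_sub j1 j2,
      integral_prod_mul (fun x : EuclideanSpace ℝ (Fin d) => ⟪x, t⟫ ^ 2 / 2) (fun _ => (1 : ℝ)),
      integral_prod_mul (fun x : EuclideanSpace ℝ (Fin d) => ⟪x, t⟫) (fun x => ⟪x, t⟫),
      integral_prod_mul (fun _ => (1 : ℝ)) (fun x : EuclideanSpace ℝ (Fin d) => ⟪x, t⟫ ^ 2 / 2),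
      integral_div]
    simp only [integral_const, probReal_univ, smul_eq_mul, mul_one]
    ring
  rw [e3, e1, e2, sq, Finset.sum_mul_sum, dotProduct, ← Finset.sum_sub_distrib]
  refine Finset.sum_congr rfl fun i _ => ?_
  rw [Matrix.mulVec, dotProduct, Finset.mul_sum, ← Finset.sum_sub_distrib]
  refine Finset.sum_congr rfl fun j _ => ?_
  rw [hM]
  ring

theorem integrable_symmetrization_norm_pow {ρ : Measure (EuclideanSpace ℝ (Fin d))}
    [IsProbabilityMeasure ρ] {k : ℕ} (hk : k ≠ 0)
    (a : EuclideanSpace ℝ (Fin d)) (hka : Integrable (fun x => ‖x - a‖ ^ k) ρ) :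
    Integrable (fun x => ‖x‖ ^ k) (symmetrization ρ) ∧
      ∫ x, ‖x‖ ^ k ∂(symmetrization ρ) ≤ 2 ^ k * ∫ x, ‖x - a‖ ^ k ∂ρ := by
  have j1 : Integrable (fun p : EuclideanSpace ℝ (Fin d) × EuclideanSpace ℝ (Fin d) =>
      ‖p.1 - a‖ ^ k * (1 : ℝ)) (ρ.prod ρ) := hka.mul_prod (integrable_const 1)
  have j2 : Integrable (fun p : EuclideanSpace ℝ (Fin d) × EuclideanSpace ℝ (Fin d) =>
      (1 : ℝ) * ‖p.2 - a‖ ^ k) (ρ.prod ρ) := (integrable_const (1 : ℝ)).mul_prod hka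
  have j3 : Integrable (fun p : EuclideanSpace ℝ (Fin d) × EuclideanSpace ℝ (Fin d) =>
      2 ^ (k - 1) * (‖p.1 - a‖ ^ k * (1 : ℝ) + 1 * ‖p.2 - a‖ ^ k)) (ρ.prod ρ) :=
    (j1.add j2).const_mul _
  have hle : ∀ p : EuclideanSpace ℝ (Fin d) × EuclideanSpace ℝ (Fin d), ‖p.1 - p.2‖ ^ k ≤
      2 ^ (k - 1) * (‖p.1 - a‖ ^ k * (1 : ℝ) + 1 * ‖p.2 - a‖ ^ k) := by
    intro p
    rw [mul_one, one_mul]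
    refine le_trans ?_ (add_pow_le (norm_nonneg _) (norm_nonneg _) k)
    gcongr
    calc ‖p.1 - p.2‖ = ‖(p.1 - a) - (p.2 - a)‖ := by rw [sub_sub_sub_cancel_right]
      _ ≤ _ := norm_sub_le _ _
  have hi : Integrable (fun p : EuclideanSpace ℝ (Fin d) × EuclideanSpace ℝ (Fin d) =>
      ‖p.1 - p.2‖ ^ k) (ρ.prod ρ) := by
    refine j3.mono' (by fun_prop) (Eventually.of_forall fun p => ?_)
    rw [Real.norm_of_nonneg (by positivity)]
    exact hle p
  refine ⟨(integrable_map_measure (by fun_prop) (by fun_prop)).2 hi, ?_⟩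
  rw [symmetrization, integral_map (by fun_prop) (by fun_prop)]
  refine (integral_mono hi j3 hle).trans ?_
  rw [integral_const_mul, integral_add j1 j2,
    integral_prod_mul (fun x : EuclideanSpace ℝ (Fin d) => ‖x - a‖ ^ k) (fun _ => (1 : ℝ)),
    integral_prod_mul (fun _ => (1 : ℝ)) (fun x : EuclideanSpace ℝ (Fin d) => ‖x - a‖ ^ k)]
  simp only [integral_const, probReal_univ, smul_eq_mul, mul_one, one_mul]
  obtain ⟨l, rfl⟩ := Nat.exists_eq_succ_of_ne_zero hk
  rw [Nat.succ_sub_one, pow_succ]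
  linarith

end SymmetrizedTilt

/-! ### Gaussian bounds for densities and exponential tilting -/

section Domination

open Module
open scoped ENNReal RealInnerProductSpace

variable {d : ℕ}

theorem withDensity_le_withDensity_of_le {α : Type*} [MeasurableSpace α] {μ ν : Measure α}
    (h : μ ≤ ν) (f : α → ℝ≥0∞) : μ.withDensity f ≤ ν.withDensity f := by
  refine Measure.le_iff.2 fun s hs => ?_
  rw [withDensity_apply _ hs, withDensity_apply _ hs]
  exact lintegral_mono' (Measure.restrict_mono le_rfl h) le_rfl

theorem expTilt_eq_withDensity {ν : Measure (EuclideanSpace ℝ (Fin d))} [IsProbabilityMeasure ν]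
    (H : ∀ t : EuclideanSpace ℝ (Fin d), Integrable (fun x => Real.exp ⟪t, x⟫) ν)
    (h : EuclideanSpace ℝ (Fin d)) :
    expTilt ν h = ν.withDensity fun x => ENNReal.ofReal (Real.exp (⟪h, x⟫ - logLaplace ν id h)) := by
  rw [expTilt, Measure.tilted]
  simp_rw [Real.exp_sub, exp_logLaplace_id H]

theorem withDensity_expTilt {ν : Measure (EuclideanSpace ℝ (Fin d))} [IsProbabilityMeasure ν]
    (H : ∀ t : EuclideanSpace ℝ (Fin d), Integrable (fun x => Real.exp ⟪t, x⟫) ν)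
    (h : EuclideanSpace ℝ (Fin d)) :
    (expTilt ν h).withDensity
      (fun x => ENNReal.ofReal (Real.exp (logLaplace ν id h - ⟪h, x⟫))) = ν := by
  rw [expTilt_eq_withDensity H, ← withDensity_mul _ (by fun_prop) (by fun_prop)]
  convert! withDensity_one using 2
  ext x
  rw [Pi.mul_apply, ← ENNReal.ofReal_mul (Real.exp_pos _).le, ← Real.exp_add]
  simp

/-- A Gaussian bound on the density turns into a Gaussian bound, centred at `k h`, on the density
of the tilted measure. -/
theorem expTilt_le_of_le_gaussian {ν : Measure (EuclideanSpace ℝ (Fin d))} [IsProbabilityMeasure ν]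
    (H : ∀ t : EuclideanSpace ℝ (Fin d), Integrable (fun x => Real.exp ⟪t, x⟫) ν)
    {C k : ℝ} (hk : 0 < k)
    (hν : ν ≤ volume.withDensity fun x => ENNReal.ofReal (C * Real.exp (-‖x‖ ^ 2 / (2 * k))))
    (h : EuclideanSpace ℝ (Fin d)) :
    expTilt ν h ≤ volume.withDensity fun x => ENNReal.ofReal
      (C * Real.exp (k * ‖h‖ ^ 2 / 2 - logLaplace ν id h) *
        Real.exp (-‖x - k • h‖ ^ 2 / (2 * k))) := by
  rw [expTilt_eq_withDensity H]
  refine (withDensity_le_withDensity_of_le hν _).trans_eq ?_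
  rw [← withDensity_mul _ (by fun_prop) (by fun_prop)]
  congr 1
  ext x
  rw [Pi.mul_apply, ← ENNReal.ofReal_mul' (Real.exp_pos _).le, mul_assoc, mul_assoc,
    ← Real.exp_add, ← Real.exp_add]
  congr 3
  rw [norm_sub_sq_real, real_inner_smul_right, norm_smul, Real.norm_of_nonneg hk.le,
    real_inner_comm h x]
  field_simp
  ring

/-- A family of bounds for the densities of the tilted measures, optimized over the tilt, is a
Gaussian bound for the density. -/
theorem le_gaussian_of_forall_expTilt_le {ν : Measure (EuclideanSpace ℝ (Fin d))}
    [IsProbabilityMeasure ν]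
    (H : ∀ t : EuclideanSpace ℝ (Fin d), Integrable (fun x => Real.exp ⟪t, x⟫) ν)
    {C k : ℝ} (hk : 0 < k)
    (hν : ∀ h : EuclideanSpace ℝ (Fin d), expTilt ν h ≤
      ENNReal.ofReal (C * Real.exp (k * ‖h‖ ^ 2 / 2 - logLaplace ν id h)) • volume) :
    ν ≤ volume.withDensity fun x => ENNReal.ofReal (C * Real.exp (-‖x‖ ^ 2 / (2 * k))) := by
  let f : EuclideanSpace ℝ (Fin d) → EuclideanSpace ℝ (Fin d) → ℝ≥0∞ := fun h x =>
    ENNReal.ofReal (C * Real.exp (k * ‖h‖ ^ 2 / 2 - ⟪h, x⟫))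
  have hf : ∀ h, ν ≤ volume.withDensity (f h) := by
    intro h
    conv_lhs => rw [← withDensity_expTilt H h]
    refine (withDensity_le_withDensity_of_le (hν h) _).trans_eq ?_
    rw [withDensity_smul_measure, ← withDensity_smul _ (by fun_prop)]
    congr 1
    ext x
    rw [Pi.smul_apply, smul_eq_mul, ← ENNReal.ofReal_mul' (Real.exp_pos _).le, mul_assoc,
      ← Real.exp_add]
    congr 3
    ring
  have hac : ν ≪ volume :=
    (Measure.absolutelyContinuous_of_le (hf 0)).trans (withDensity_absolutelyContinuous _ _)
  have hrn : volume.withDensity (ν.rnDeriv volume) = ν := Measure.withDensity_rnDeriv_eq _ _ hac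
  have hae : ∀ h, ν.rnDeriv volume ≤ᵐ[volume] f h := by
    intro h
    refine ae_le_of_forall_setLIntegral_le_of_sigmaFinite (Measure.measurable_rnDeriv _ _)
      fun s hs _ => ?_
    rw [← withDensity_apply _ hs, ← withDensity_apply _ hs, hrn]
    exact hf h s
  obtain ⟨D, hDc, hDd⟩ := TopologicalSpace.exists_countable_dense (EuclideanSpace ℝ (Fin d))
  have hall : ∀ᵐ x, ∀ h ∈ D, ν.rnDeriv volume x ≤ f h x :=
    (ae_ball_iff hDc).2 fun h _ => hae h
  rw [← hrn]
  refine withDensity_mono ?_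
  filter_upwards [hall] with x hx
  have hcl : IsClosed {h | ν.rnDeriv volume x ≤ f h x} :=
    isClosed_le continuous_const (ENNReal.continuous_ofReal.comp (by fun_prop))
  have hmem : ν.rnDeriv volume x ≤ f (k⁻¹ • x) x := by
    have : closure D ⊆ {h | ν.rnDeriv volume x ≤ f h x} := closure_minimal hx hcl
    exact this (hDd.closure_eq ▸ Set.mem_univ _)
  refine hmem.trans_eq ?_
  simp only [f]
  congr 3
  rw [norm_smul, real_inner_smul_left, real_inner_self_eq_norm_sq, Real.norm_of_nonneg (by positivity)]
  field_simp
  ring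

theorem stdNormalDensity_pos (x : EuclideanSpace ℝ (Fin d)) : 0 < stdNormalDensity d x := by
  unfold stdNormalDensity
  positivity

theorem continuous_stdNormalDensity : Continuous (stdNormalDensity d) := by
  unfold stdNormalDensity
  fun_prop

theorem stdNormalDensity_eq (x : EuclideanSpace ℝ (Fin d)) :
    stdNormalDensity d x = (2 * Real.pi) ^ (-(d : ℝ) / 2) * Real.exp (-(1 / 2) * ‖x‖ ^ 2) := by
  unfold stdNormalDensity
  ring_nf

theorem integrable_stdNormalDensity : Integrable (stdNormalDensity d) := by
  simp_rw [funext (stdNormalDensity_eq (d := d))]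
  exact (integrable_exp_neg_mul_sq_norm (by norm_num)).const_mul _

theorem integral_stdNormalDensity : ∫ x, stdNormalDensity d x = 1 := by
  simp_rw [stdNormalDensity_eq]
  rw [integral_const_mul, GaussianFourier.integral_rexp_neg_mul_sq_norm (by norm_num),
    finrank_euclideanSpace_fin, show Real.pi / (1 / 2) = 2 * Real.pi by ring,
    ← Real.rpow_add (by positivity), neg_div, neg_add_cancel, Real.rpow_zero]

/-- `T_∞(p‖φ) ≤ c - 1` means that `p ≤ c φ` almost everywhere. -/
theorem tsallisInf_le_iff {ζ : Measure (EuclideanSpace ℝ (Fin d))} [IsProbabilityMeasure ζ]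
    {c : ℝ} (hc : 0 ≤ c) :
    tsallisInf ζ ≤ ((c - 1 : ℝ) : EReal) ↔
      ζ ≤ volume.withDensity fun x => ENNReal.ofReal (c * stdNormalDensity d x) := by
  have hiff : ∀ x : EuclideanSpace ℝ (Fin d), ζ.rnDeriv volume x ≠ ∞ →
      (((((ζ.rnDeriv volume x).toReal - stdNormalDensity d x) / stdNormalDensity d x : ℝ) : EReal) ≤
        ((c - 1 : ℝ) : EReal) ↔ ζ.rnDeriv volume x ≤ ENNReal.ofReal (c * stdNormalDensity d x)) := by
    intro x hx
    rw [EReal.coe_le_coe_iff, div_le_iff₀ (stdNormalDensity_pos x),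
      ENNReal.le_ofReal_iff_toReal_le hx (mul_nonneg hc (stdNormalDensity_pos x).le)]
    constructor <;> intro h <;> linarith
  constructor
  · intro h
    have hac : ζ ≪ volume := by
      by_contra hac
      rw [tsallisInf, if_neg hac, top_le_iff] at h
      exact EReal.coe_ne_top _ h
    rw [tsallisInf, if_pos hac] at h
    conv_lhs => rw [← Measure.withDensity_rnDeriv_eq ζ volume hac]
    refine withDensity_mono ?_
    filter_upwards [ae_le_essSup (μ := volume) (f := fun x => ((((ζ.rnDeriv volume x).toReal -
      stdNormalDensity d x) / stdNormalDensity d x : ℝ) : EReal)), ζ.rnDeriv_ne_top volume]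
      with x hx hx'
    exact (hiff x hx').1 (hx.trans h)
  · intro h
    have hac : ζ ≪ volume :=
      (Measure.absolutelyContinuous_of_le h).trans (withDensity_absolutelyContinuous _ _)
    rw [tsallisInf, if_pos hac]
    refine essSup_le_of_ae_le _ ?_
    have hae : ζ.rnDeriv volume ≤ᵐ[volume] fun x => ENNReal.ofReal (c * stdNormalDensity d x) := by
      refine ae_le_of_forall_setLIntegral_le_of_sigmaFinite (Measure.measurable_rnDeriv _ _)
        fun s hs _ => ?_
      rw [← withDensity_apply _ hs, ← withDensity_apply _ hs,
        Measure.withDensity_rnDeriv_eq _ _ hac]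
      exact h s
    filter_upwards [hae, ζ.rnDeriv_ne_top volume] with x hx hx'
    exact (hiff x hx').2 hx

theorem one_le_of_le_withDensity_stdNormalDensity {ζ : Measure (EuclideanSpace ℝ (Fin d))}
    [IsProbabilityMeasure ζ] {c : ℝ} (hc : 0 ≤ c)
    (h : ζ ≤ volume.withDensity fun x => ENNReal.ofReal (c * stdNormalDensity d x)) : 1 ≤ c := by
  have h1 := h Set.univ
  rw [measure_univ, withDensity_apply _ MeasurableSet.univ, Measure.restrict_univ,
    ← ofReal_integral_eq_lintegral_ofReal (integrable_stdNormalDensity.const_mul c)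
      (Eventually.of_forall fun x => mul_nonneg hc (stdNormalDensity_pos x).le),
    integral_const_mul, integral_stdNormalDensity, mul_one] at h1
  exact ENNReal.one_le_ofReal.1 h1

/-- Both densities have total mass one. -/
theorem tsallisInf_nonneg (ζ : Measure (EuclideanSpace ℝ (Fin d))) [IsProbabilityMeasure ζ] :
    0 ≤ tsallisInf ζ := by
  by_contra! hlt
  obtain ⟨q, hq, hq0⟩ := EReal.lt_iff_exists_real_btwn.1 hlt
  have hq0' : q < 0 := by exact_mod_cast hq0
  have hc : (0 : ℝ) ≤ max 0 (q + 1) := le_max_left _ _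
  have h1 : tsallisInf ζ ≤ ((max 0 (q + 1) - 1 : ℝ) : EReal) := by
    refine hq.le.trans (EReal.coe_le_coe_iff.2 ?_)
    linarith [le_max_right 0 (q + 1)]
  have h2 := one_le_of_le_withDensity_stdNormalDensity hc ((tsallisInf_le_iff hc).1 h1)
  rcases le_max_iff.1 h2 with h | h <;> linarith

theorem map_smul_withDensity_volume {s : ℝ} (hs : 0 < s) {g : EuclideanSpace ℝ (Fin d) → ℝ}
    (hg : Measurable g) :
    (volume.withDensity fun x => ENNReal.ofReal (g x)).map (fun x => s • x) =
      volume.withDensity fun x => ENNReal.ofReal ((s ^ d)⁻¹ * g (s⁻¹ • x)) := by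
  have hm : Measurable fun x : EuclideanSpace ℝ (Fin d) => s • x := by fun_prop
  ext S hS
  rw [Measure.map_apply hm hS, withDensity_apply _ (hm hS), withDensity_apply _ hS,
    ← lintegral_indicator (hm hS), ← lintegral_indicator hS]
  have hmap := Measure.map_addHaar_smul (volume : Measure (EuclideanSpace ℝ (Fin d))) hs.ne'
  let F : EuclideanSpace ℝ (Fin d) → ℝ≥0∞ := S.indicator fun x => ENNReal.ofReal (g (s⁻¹ • x))
  have hF : Measurable F := Measurable.indicator (by fun_prop) hS
  have e1 : ∫⁻ x, ((fun x => s • x) ⁻¹' S).indicator (fun x => ENNReal.ofReal (g x)) x =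
      ∫⁻ x, F (s • x) := by
    congr 1 with x
    by_cases hx : s • x ∈ S
    · rw [Set.indicator_of_mem (by exact hx)]
      simp [F, hx, smul_smul, inv_mul_cancel₀ hs.ne']
    · rw [Set.indicator_of_notMem (by exact hx)]
      simp [F, hx]
  rw [e1, ← lintegral_map hF hm, hmap, lintegral_smul_measure, finrank_euclideanSpace_fin,
    abs_of_nonneg (by positivity), smul_eq_mul, ← lintegral_const_mul _ hF]
  congr 1 with x
  by_cases hx : x ∈ S
  · simp only [F, Set.indicator_of_mem hx]
    rw [ENNReal.ofReal_mul (by positivity)]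
  · simp [F, hx]

/-- The density `c φ` after the scaling by `√n`. -/
theorem map_sqrt_smul_le_iff {ν : Measure (EuclideanSpace ℝ (Fin d))} {n : ℝ} (hn : 0 < n) (c : ℝ) :
    ν.map (fun x => (Real.sqrt n)⁻¹ • x) ≤
        (volume.withDensity fun x => ENNReal.ofReal (c * stdNormalDensity d x)) ↔
      ν ≤ volume.withDensity fun x => ENNReal.ofReal
        (c * (2 * Real.pi * n) ^ (-(d : ℝ) / 2) * Real.exp (-‖x‖ ^ 2 / (2 * n))) := by
  set s := Real.sqrt n with hs
  have hs0 : 0 < s := Real.sqrt_pos.2 hn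
  have hsd : (s ^ d)⁻¹ = n ^ (-(d : ℝ) / 2) := by
    rw [hs, Real.sqrt_eq_rpow, ← Real.rpow_natCast, ← Real.rpow_mul hn.le, ← Real.rpow_neg hn.le]
    congr 1; ring
  have hmap : (volume.withDensity fun x => ENNReal.ofReal (c * stdNormalDensity d x)).map
      (fun x => s • x) = volume.withDensity fun x => ENNReal.ofReal
        (c * (2 * Real.pi * n) ^ (-(d : ℝ) / 2) * Real.exp (-‖x‖ ^ 2 / (2 * n))) := by
    rw [map_smul_withDensity_volume hs0 (continuous_stdNormalDensity.measurable.const_mul c)]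
    congr 1 with x
    rw [hsd, stdNormalDensity, Real.mul_rpow (x := 2 * Real.pi) (by positivity) hn.le, norm_smul,
      norm_inv, Real.norm_of_nonneg hs0.le, mul_pow, inv_pow, hs, Real.sq_sqrt hn.le,
      show -(n⁻¹ * ‖x‖ ^ 2) / 2 = -‖x‖ ^ 2 / (2 * n) by field_simp]
    ring_nf
  have hm : Measurable fun x : EuclideanSpace ℝ (Fin d) => s • x := by fun_prop
  have hm' : Measurable fun x : EuclideanSpace ℝ (Fin d) => s⁻¹ • x := by fun_prop
  constructor
  · intro h
    have h1 := Measure.map_mono h hm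
    rw [hmap, Measure.map_map hm hm'] at h1
    have : ((fun x : EuclideanSpace ℝ (Fin d) => s • x) ∘ fun x => s⁻¹ • x) = id := by
      ext1 x; simp [smul_smul, hs0.ne']
    rwa [this, Measure.map_id] at h1
  · intro h
    rw [← hmap] at h
    have h1 := Measure.map_mono h hm'
    rw [Measure.map_map hm' hm] at h1
    have : ((fun x : EuclideanSpace ℝ (Fin d) => s⁻¹ • x) ∘ fun x => s • x) = id := by
      ext1 x; simp [smul_smul, hs0.ne']
    rwa [this, Measure.map_id] at h1

end Domination

/-! ### Sums of independent copies -/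

section IndependentSums

open Module
open scoped ENNReal RealInnerProductSpace

variable {d : ℕ} {Ω : Type*} [MeasurableSpace Ω] {P : Measure Ω}
  {X : ℕ → Ω → EuclideanSpace ℝ (Fin d)}

/-- The law of the partial sum `X_0 + ⋯ + X_(n-1)`. -/
def sumLaw (P : Measure Ω) (X : ℕ → Ω → EuclideanSpace ℝ (Fin d)) (n : ℕ) :
    Measure (EuclideanSpace ℝ (Fin d)) :=
  P.map fun ω => ∑ i ∈ Finset.range n, X i ω

theorem aemeasurable_sum_range (hident : ∀ i, IdentDistrib (X i) (X 0) P P) (n : ℕ) :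
    AEMeasurable (fun ω => ∑ i ∈ Finset.range n, X i ω) P :=
  Finset.aemeasurable_fun_sum _ fun i _ => (hident i).aemeasurable_fst

theorem map_normalizedSum (hident : ∀ i, IdentDistrib (X i) (X 0) P P) (n : ℕ) :
    P.map (normalizedSum X n) = (sumLaw P X n).map fun x => (Real.sqrt n)⁻¹ • x := by
  rw [sumLaw, AEMeasurable.map_map_of_aemeasurable (by fun_prop) (aemeasurable_sum_range hident n)]
  rfl

variable [IsProbabilityMeasure P]

theorem isProbabilityMeasure_sumLaw (hident : ∀ i, IdentDistrib (X i) (X 0) P P) (n : ℕ) :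
    IsProbabilityMeasure (sumLaw P X n) :=
  Measure.isProbabilityMeasure_map (aemeasurable_sum_range hident n)

/-- The integral of a multiplicative function against the law of a sum of independent copies. -/
theorem integral_sumLaw_of_multiplicative {𝕜 : Type*} [RCLike 𝕜] (hindep : iIndepFun X P)
    (hident : ∀ i, IdentDistrib (X i) (X 0) P P) {F : EuclideanSpace ℝ (Fin d) → 𝕜}
    (hF : Continuous F) (h0 : F 0 = 1) (hadd : ∀ x y, F (x + y) = F x * F y) (n : ℕ) :
    ∫ x, F x ∂(sumLaw P X n) = (∫ ω, F (X 0 ω) ∂P) ^ n := by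
  rw [sumLaw, integral_map (aemeasurable_sum_range hident n) hF.aestronglyMeasurable]
  induction n with
  | zero => simp [h0]
  | succ n ih =>
    simp_rw [Finset.sum_range_succ, hadd]
    have hI : IndepFun (fun ω => ∑ i ∈ Finset.range n, X i ω) (X n) P := by
      have := hindep.indepFun_finsetSum_of_notMem₀ (fun i => (hident i).aemeasurable_fst)
        (Finset.notMem_range_self (n := n))
      convert! this using 1
      ext1 ω
      rw [Finset.sum_apply]
    rw [hI.integral_fun_comp_mul_comp (aemeasurable_sum_range hident n)
      (hident n).aemeasurable_fst hF.aestronglyMeasurable hF.aestronglyMeasurable, ih, pow_succ]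
    congr 1
    exact ((hident n).comp hF.measurable).integral_eq

theorem integral_exp_sumLaw (hindep : iIndepFun X P) (hident : ∀ i, IdentDistrib (X i) (X 0) P P)
    (n : ℕ) (t : EuclideanSpace ℝ (Fin d)) :
    ∫ x, Real.exp ⟪t, x⟫ ∂(sumLaw P X n) = (∫ ω, Real.exp ⟪t, X 0 ω⟫ ∂P) ^ n :=
  integral_sumLaw_of_multiplicative hindep hident (F := fun x => Real.exp ⟪t, x⟫) (by fun_prop)
    (by simp) (fun x y => by rw [inner_add_right, Real.exp_add]) n

theorem integrable_exp_sumLaw (hindep : iIndepFun X P) (hident : ∀ i, IdentDistrib (X i) (X 0) P P)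
    (hsub : StrictlySubGaussian P (X 0)) (n : ℕ) (t : EuclideanSpace ℝ (Fin d)) :
    Integrable (fun x => Real.exp ⟪t, x⟫) (sumLaw P X n) := by
  refine Integrable.of_integral_ne_zero ?_
  rw [integral_exp_sumLaw hindep hident]
  exact pow_ne_zero _ (integral_exp_pos (hsub t).1).ne'

theorem logLaplace_sumLaw (hindep : iIndepFun X P) (hident : ∀ i, IdentDistrib (X i) (X 0) P P)
    (n : ℕ) (t : EuclideanSpace ℝ (Fin d)) :
    logLaplace (sumLaw P X n) id t = n * logLaplace P (X 0) t := by
  rw [logLaplace, logLaplace, ← Real.log_pow, ← integral_exp_sumLaw hindep hident]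
  rfl

theorem logLaplace_sumLaw_one (hindep : iIndepFun X P)
    (hident : ∀ i, IdentDistrib (X i) (X 0) P P) :
    logLaplace (sumLaw P X 1) id = logLaplace P (X 0) := by
  ext t
  rw [logLaplace_sumLaw hindep hident, Nat.cast_one, one_mul]

theorem hessianMatrix_const_mul (c : ℝ) (f : EuclideanSpace ℝ (Fin d) → ℝ)
    (t : EuclideanSpace ℝ (Fin d)) :
    hessianMatrix (fun s => c * f s) t = c • hessianMatrix f t := by
  have h : ∀ (g : EuclideanSpace ℝ (Fin d) → ℝ) (s v : EuclideanSpace ℝ (Fin d)),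
      fderiv ℝ (fun s => c * g s) s v = c * fderiv ℝ g s v := by
    intro g s v
    have := congrFun (fderiv_const_smul_field (𝕜 := ℝ) (f := g) c) s
    exact congrArg (fun L : EuclideanSpace ℝ (Fin d) →L[ℝ] ℝ => L v) this
  ext i j
  simp only [hessianMatrix, Matrix.of_apply, Matrix.smul_apply, smul_eq_mul, h]

theorem hessianMatrix_logLaplace_sumLaw (hindep : iIndepFun X P)
    (hident : ∀ i, IdentDistrib (X i) (X 0) P P) (n : ℕ) (t : EuclideanSpace ℝ (Fin d)) :
    hessianMatrix (logLaplace (sumLaw P X n) id) t =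
      (n : ℝ) • hessianMatrix (logLaplace P (X 0)) t := by
  rw [← hessianMatrix_const_mul, ← funext (logLaplace_sumLaw hindep hident n)]

theorem hessianMatrix_gaussGap (hindep : iIndepFun X P)
    (hident : ∀ i, IdentDistrib (X i) (X 0) P P) (hsub : StrictlySubGaussian P (X 0))
    (t : EuclideanSpace ℝ (Fin d)) :
    hessianMatrix (gaussGap P (X 0)) t = 1 - hessianMatrix (logLaplace P (X 0)) t := by
  have := isProbabilityMeasure_sumLaw hident 1
  have h := hessianMatrix_sq_norm_sub_logLaplace (integrable_exp_sumLaw hindep hident hsub 1) t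
  rwa [logLaplace_sumLaw_one hindep hident] at h

theorem continuous_hessianMatrix_gaussGap (hindep : iIndepFun X P)
    (hident : ∀ i, IdentDistrib (X i) (X 0) P P) (hsub : StrictlySubGaussian P (X 0)) :
    Continuous (hessianMatrix (gaussGap P (X 0))) := by
  have := isProbabilityMeasure_sumLaw hident 1
  have h := continuous_hessianMatrix_logLaplace (integrable_exp_sumLaw hindep hident hsub 1)
  rw [logLaplace_sumLaw_one hindep hident] at h
  rw [funext (hessianMatrix_gaussGap hindep hident hsub)]
  exact continuous_const.sub h

theorem continuous_gaussGap (hindep : iIndepFun X P)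
    (hident : ∀ i, IdentDistrib (X i) (X 0) P P) (hsub : StrictlySubGaussian P (X 0)) :
    Continuous (gaussGap P (X 0)) := by
  have := isProbabilityMeasure_sumLaw hident 1
  have h := continuous_logLaplace (integrable_exp_sumLaw hindep hident hsub 1)
  rw [logLaplace_sumLaw_one hindep hident] at h
  have e : gaussGap P (X 0) = fun t => ‖t‖ ^ 2 / 2 - logLaplace P (X 0) t := rfl
  rw [e]
  fun_prop

theorem mul_sq_norm_sub_logLaplace_sumLaw (hindep : iIndepFun X P)
    (hident : ∀ i, IdentDistrib (X i) (X 0) P P) (n : ℕ) (h : EuclideanSpace ℝ (Fin d)) :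
    n * ‖h‖ ^ 2 / 2 - logLaplace (sumLaw P X n) id h = n * gaussGap P (X 0) h := by
  rw [logLaplace_sumLaw hindep hident, gaussGap]
  ring

theorem norm_charFun_expTilt_sumLaw (hindep : iIndepFun X P)
    (hident : ∀ i, IdentDistrib (X i) (X 0) P P) (n : ℕ) (h t : EuclideanSpace ℝ (Fin d)) :
    ‖charFun (expTilt (sumLaw P X n) h) t‖ =
      (‖∫ ω, Complex.exp (⟪h, X 0 ω⟫ + ⟪X 0 ω, t⟫ * Complex.I) ∂P‖ /
        ∫ ω, Real.exp ⟪h, X 0 ω⟫ ∂P) ^ n := by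
  have e : charFun (expTilt (sumLaw P X n) h) t =
      (∫ x, Complex.exp (⟪h, x⟫ + ⟪x, t⟫ * Complex.I) ∂(sumLaw P X n)) /
        ((∫ x, Real.exp ⟪h, x⟫ ∂(sumLaw P X n) : ℝ) : ℂ) := by
    rw [charFun_apply, expTilt, integral_tilted, ← integral_div]
    congr 1 with x
    rw [Complex.real_smul, Complex.exp_add]
    push_cast
    ring
  rw [e, integral_exp_sumLaw hindep hident,
    integral_sumLaw_of_multiplicative hindep hident (𝕜 := ℂ)
      (F := fun x => Complex.exp (⟪h, x⟫ + ⟪x, t⟫ * Complex.I)) (by fun_prop) (by simp)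
      (fun x y => by
        rw [inner_add_right, inner_add_left, ← Complex.exp_add]; push_cast; ring_nf) n,
    norm_div, norm_pow, Complex.norm_real, norm_pow, Real.norm_of_nonneg
      (integral_nonneg fun ω => (Real.exp_pos _).le), div_pow]

/-- Characteristic functions of the tilted laws of two partial sums are powers of each other. -/
theorem norm_charFun_expTilt_sumLaw_eq_rpow (hindep : iIndepFun X P)
    (hident : ∀ i, IdentDistrib (X i) (X 0) P P) {k : ℕ} (hk : k ≠ 0) (n : ℕ)
    (h t : EuclideanSpace ℝ (Fin d)) :
    ‖charFun (expTilt (sumLaw P X n) h) t‖ =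
      (‖charFun (expTilt (sumLaw P X k) h) t‖ ^ 2) ^ ((n : ℝ) / (2 * k)) := by
  rw [norm_charFun_expTilt_sumLaw hindep hident, norm_charFun_expTilt_sumLaw hindep hident]
  set a := ‖∫ ω, Complex.exp (⟪h, X 0 ω⟫ + ⟪X 0 ω, t⟫ * Complex.I) ∂P‖ /
        ∫ ω, Real.exp ⟪h, X 0 ω⟫ ∂P
  have ha : 0 ≤ a := div_nonneg (norm_nonneg _) (integral_nonneg fun ω => (Real.exp_pos _).le)
  have hk' : (k : ℝ) ≠ 0 := Nat.cast_ne_zero.2 hk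
  rw [← pow_mul, ← Real.rpow_natCast a (k * 2), ← Real.rpow_mul ha, ← Real.rpow_natCast]
  congr 1
  push_cast
  field_simp

end IndependentSums

/-! ### A uniform local limit bound for the tilted laws -/

section LocalLimit

open Module
open scoped ENNReal RealInnerProductSpace

variable {d : ℕ} {Ω : Type*} [MeasurableSpace Ω] {P : Measure Ω} [IsProbabilityMeasure P]
  {X : ℕ → Ω → EuclideanSpace ℝ (Fin d)}

theorem ofReal_smul_le_ofReal_smul {α : Type*} [MeasurableSpace α] {a b : ℝ} (hab : a ≤ b)
    (μ : Measure α) : ENNReal.ofReal a • μ ≤ ENNReal.ofReal b • μ :=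
  Measure.le_iff.2 fun s _ => by
    rw [Measure.smul_apply, Measure.smul_apply, smul_eq_mul, smul_eq_mul]
    gcongr

theorem integral_norm_pow_four_le_of_le_gaussian {ρ : Measure (EuclideanSpace ℝ (Fin d))}
    {C k : ℝ} (hC : 0 ≤ C) (hk : 0 < k) (a : EuclideanSpace ℝ (Fin d))
    (hρ : ρ ≤ volume.withDensity fun x => ENNReal.ofReal
      (C * Real.exp (-‖x - a‖ ^ 2 / (2 * k)))) :
    Integrable (fun x => ‖x - a‖ ^ 4) ρ ∧ ∫ x, ‖x - a‖ ^ 4 ∂ρ ≤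
      C * ∫ x : EuclideanSpace ℝ (Fin d), ‖x‖ ^ 4 * Real.exp (-(2 * k)⁻¹ * ‖x‖ ^ 2) := by
  have hg := (integrable_norm_pow_four_mul_gaussian (E := EuclideanSpace ℝ (Fin d))
    (b := (2 * k)⁻¹) (by positivity))
  have hg' := (hg.comp_sub_right a).const_mul C
  have hle : ∫⁻ x, ENNReal.ofReal (‖x - a‖ ^ 4) ∂ρ ≤ ENNReal.ofReal
      (C * ∫ x : EuclideanSpace ℝ (Fin d), ‖x‖ ^ 4 * Real.exp (-(2 * k)⁻¹ * ‖x‖ ^ 2)) := by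
    refine (lintegral_mono' hρ le_rfl).trans ?_
    rw [lintegral_withDensity_eq_lintegral_mul _ (by fun_prop) (by fun_prop),
      ← integral_sub_right_eq_self (fun x : EuclideanSpace ℝ (Fin d) =>
        ‖x‖ ^ 4 * Real.exp (-(2 * k)⁻¹ * ‖x‖ ^ 2)) a, ← integral_const_mul,
      ofReal_integral_eq_lintegral_ofReal hg' (Eventually.of_forall fun x => by positivity)]
    refine lintegral_mono fun x => ?_
    rw [Pi.mul_apply, ← ENNReal.ofReal_mul (by positivity)]
    refine ENNReal.ofReal_le_ofReal (le_of_eq ?_)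
    rw [show -‖x - a‖ ^ 2 / (2 * k) = -(2 * k)⁻¹ * ‖x - a‖ ^ 2 by field_simp]
    ring
  have hi : Integrable (fun x => ‖x - a‖ ^ 4) ρ := by
    refine ⟨by fun_prop, ?_⟩
    rw [hasFiniteIntegral_iff_ofReal (Eventually.of_forall fun t => by positivity)]
    exact hle.trans_lt ENNReal.ofReal_lt_top
  refine ⟨hi, ?_⟩
  rw [← ofReal_integral_eq_lintegral_ofReal hi (Eventually.of_forall fun t => by positivity)] at hle
  refine (ENNReal.ofReal_le_ofReal_iff ?_).1 hle
  exact mul_nonneg hC (integral_nonneg fun x => by positivity)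

/-- A Gaussian bound for the density of the sum of `k` summands bounds the density of the tilted law
of this sum. -/
theorem expTilt_sumLaw_le_of_le_gaussian (hindep : iIndepFun X P)
    (hident : ∀ i, IdentDistrib (X i) (X 0) P P) (hsub : StrictlySubGaussian P (X 0))
    {k : ℕ} (hk : k ≠ 0) {C : ℝ}
    (hν : sumLaw P X k ≤ volume.withDensity fun x => ENNReal.ofReal
      (C * Real.exp (-‖x‖ ^ 2 / (2 * k)))) (h : EuclideanSpace ℝ (Fin d)) :
    expTilt (sumLaw P X k) h ≤ volume.withDensity fun x => ENNReal.ofReal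
      (C * Real.exp (k * gaussGap P (X 0) h) *
        Real.exp (-‖x - (k : ℝ) • h‖ ^ 2 / (2 * k))) := by
  have := isProbabilityMeasure_sumLaw hident k
  have h1 := expTilt_le_of_le_gaussian (integrable_exp_sumLaw hindep hident hsub k)
    (Nat.cast_pos.2 (Nat.pos_of_ne_zero hk)) hν h
  rwa [mul_sq_norm_sub_logLaplace_sumLaw hindep hident] at h1

theorem expTilt_sumLaw_le_smul_volume (hindep : iIndepFun X P)
    (hident : ∀ i, IdentDistrib (X i) (X 0) P P) (hsub : StrictlySubGaussian P (X 0))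
    {k : ℕ} (hk : k ≠ 0) {C : ℝ} (hC : 0 ≤ C)
    (hν : sumLaw P X k ≤ volume.withDensity fun x => ENNReal.ofReal
      (C * Real.exp (-‖x‖ ^ 2 / (2 * k)))) (h : EuclideanSpace ℝ (Fin d)) :
    expTilt (sumLaw P X k) h ≤
      ENNReal.ofReal (C * Real.exp (k * gaussGap P (X 0) h)) • volume := by
  refine (expTilt_sumLaw_le_of_le_gaussian hindep hident hsub hk hν h).trans ?_
  rw [← withDensity_const]
  refine withDensity_mono (Eventually.of_forall fun x => ENNReal.ofReal_le_ofReal ?_)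
  refine mul_le_of_le_one_right (by positivity) (Real.exp_le_one_iff.2 ?_)
  exact div_nonpos_of_nonpos_of_nonneg (by simp) (by positivity)

theorem isProbabilityMeasure_expTilt_sumLaw (hindep : iIndepFun X P)
    (hident : ∀ i, IdentDistrib (X i) (X 0) P P) (hsub : StrictlySubGaussian P (X 0)) (n : ℕ)
    (h : EuclideanSpace ℝ (Fin d)) : IsProbabilityMeasure (expTilt (sumLaw P X n) h) :=
  have := isProbabilityMeasure_sumLaw hident n
  isProbabilityMeasure_expTilt (integrable_exp_sumLaw hindep hident hsub n h)

/-- Fourier inversion bounds the density of the tilted law of a sum of `n` summands by an integral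
of a power of the squared characteristic function of the tilted law of `k` summands. -/
theorem expTilt_sumLaw_le_integral_rpow (hindep : iIndepFun X P)
    (hident : ∀ i, IdentDistrib (X i) (X 0) P P) (hsub : StrictlySubGaussian P (X 0))
    {k : ℕ} (hk : k ≠ 0) {n : ℕ} (hn : 2 * k ≤ n) (h : EuclideanSpace ℝ (Fin d))
    (hi : Integrable fun t => ‖charFun (expTilt (sumLaw P X k) h) t‖ ^ 2) :
    expTilt (sumLaw P X n) h ≤ ENNReal.ofReal (((2 * Real.pi) ^ d)⁻¹ *
      ∫ t, (‖charFun (expTilt (sumLaw P X k) h) t‖ ^ 2) ^ ((n : ℝ) / (2 * k))) • volume ∧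
    ∫ t, (‖charFun (expTilt (sumLaw P X k) h) t‖ ^ 2) ^ ((n : ℝ) / (2 * k)) ≤
      ∫ t, ‖charFun (expTilt (sumLaw P X k) h) t‖ ^ 2 := by
  have := isProbabilityMeasure_expTilt_sumLaw hindep hident hsub n h
  have := isProbabilityMeasure_expTilt_sumLaw hindep hident hsub k h
  have hk0 : 0 < (k : ℝ) := Nat.cast_pos.2 (Nat.pos_of_ne_zero hk)
  have hm : 1 ≤ (n : ℝ) / (2 * k) := by
    rw [one_le_div (by positivity)]
    exact_mod_cast hn
  have hle : ∀ t, (‖charFun (expTilt (sumLaw P X k) h) t‖ ^ 2) ^ ((n : ℝ) / (2 * k)) ≤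
      ‖charFun (expTilt (sumLaw P X k) h) t‖ ^ 2 := by
    intro t
    refine Real.rpow_le_self_of_le_one (by positivity) ?_ hm
    exact pow_le_one₀ (norm_nonneg _) (norm_charFun_le_one t)
  have e : ∀ t, ‖charFun (expTilt (sumLaw P X n) h) t‖ =
      (‖charFun (expTilt (sumLaw P X k) h) t‖ ^ 2) ^ ((n : ℝ) / (2 * k)) := fun t =>
    norm_charFun_expTilt_sumLaw_eq_rpow hindep hident hk n h t
  have hin : Integrable (charFun (expTilt (sumLaw P X n) h)) := by
    refine hi.mono' measurable_charFun.aestronglyMeasurable (Eventually.of_forall fun t => ?_)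
    rw [e]
    exact hle t
  have h1 := le_smul_volume_of_integrable_charFun _ hin
  rw [finrank_euclideanSpace_fin] at h1
  simp_rw [← e]
  refine ⟨h1, integral_mono hin.norm hi fun t => ?_⟩
  simp only [e]
  exact hle t

/-- The density of the tilted law of a sum of many summands inherits the bound for the density of
the tilted law of a sum of `k` summands. -/
theorem expTilt_sumLaw_le_of_two_mul_le (hindep : iIndepFun X P)
    (hident : ∀ i, IdentDistrib (X i) (X 0) P P) (hsub : StrictlySubGaussian P (X 0))
    {k : ℕ} (hk : k ≠ 0) {C : ℝ} (hC : 0 ≤ C)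
    (hν : sumLaw P X k ≤ volume.withDensity fun x => ENNReal.ofReal
      (C * Real.exp (-‖x‖ ^ 2 / (2 * k)))) {n : ℕ} (hn : 2 * k ≤ n)
    (h : EuclideanSpace ℝ (Fin d)) :
    expTilt (sumLaw P X n) h ≤
      ENNReal.ofReal (C * Real.exp (k * gaussGap P (X 0) h)) • volume := by
  have := isProbabilityMeasure_expTilt_sumLaw hindep hident hsub k h
  obtain ⟨hi, hI⟩ := integral_sq_charFun_le (expTilt (sumLaw P X k) h) (by positivity)
    (expTilt_sumLaw_le_smul_volume hindep hident hsub hk hC hν h)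
  obtain ⟨h1, h2⟩ := expTilt_sumLaw_le_integral_rpow hindep hident hsub hk hn h hi
  refine h1.trans (ofReal_smul_le_ofReal_smul ?_ _)
  rw [finrank_euclideanSpace_fin] at hI
  rw [inv_mul_le_iff₀ (by positivity)]
  exact h2.trans hI

/-- The upper half of a local limit theorem for the tilted laws, uniform over all tilts `h` with
`A(h) ≤ 1`. -/
theorem exists_uniform_local_limit_bound (hindep : iIndepFun X P)
    (hident : ∀ i, IdentDistrib (X i) (X 0) P P) (hsub : StrictlySubGaussian P (X 0))
    {k : ℕ} (hk : k ≠ 0) {C : ℝ} (hC : 0 ≤ C)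
    (hν : sumLaw P X k ≤ volume.withDensity fun x => ENNReal.ofReal
      (C * Real.exp (-‖x‖ ^ 2 / (2 * k)))) :
    ∃ err : ℕ → ℝ, Tendsto err atTop (𝓝 0) ∧ ∀ h, gaussGap P (X 0) h ≤ 1 → ∀ n : ℕ, 2 * k ≤ n →
      expTilt (sumLaw P X n) h ≤ ENNReal.ofReal ((2 * Real.pi * n) ^ (-(d : ℝ) / 2) *
        ((Real.sqrt (hessianMatrix (logLaplace P (X 0)) h).det)⁻¹ + err n)) • volume := by
  have hk0 : 0 < (k : ℝ) := Nat.cast_pos.2 (Nat.pos_of_ne_zero hk)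
  set J : ℝ := C * Real.exp k with hJ
  have hJ0 : 0 ≤ J := by positivity
  set B : ℝ := 2 ^ 4 * (J * ∫ x : EuclideanSpace ℝ (Fin d),
    ‖x‖ ^ 4 * Real.exp (-(2 * (k : ℝ))⁻¹ * ‖x‖ ^ 2)) with hB
  obtain ⟨c, hc, e, he, H⟩ := exists_uniform_laplace_bound (E := EuclideanSpace ℝ (Fin d))
    (1 + B) B ((2 * Real.pi) ^ d * J)
  refine ⟨fun n => (k / Real.pi) ^ ((d : ℝ) / 2) * e ((n : ℝ) / (2 * k)), ?_, ?_⟩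
  · have h1 : Tendsto (fun n : ℕ => (n : ℝ) / (2 * k)) atTop atTop :=
      tendsto_natCast_atTop_atTop.atTop_div_const (by positivity)
    simpa using (he.comp h1).const_mul (((k : ℝ) / Real.pi) ^ ((d : ℝ) / 2))
  intro h hA n hn
  have hpk := isProbabilityMeasure_sumLaw (P := P) (X := X) hident k
  have hp := isProbabilityMeasure_expTilt_sumLaw hindep hident hsub k h
  have hint := integrable_exp_sumLaw hindep hident hsub k
  set ρ := expTilt (sumLaw P X k) h with hρ
  have hJle : C * Real.exp (k * gaussGap P (X 0) h) ≤ J := by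
    rw [hJ]
    gcongr
    nlinarith
  have hρ1 : ρ ≤ ENNReal.ofReal J • volume :=
    (expTilt_sumLaw_le_smul_volume hindep hident hsub hk hC hν h).trans
      (ofReal_smul_le_ofReal_smul hJle _)
  have hρ2 : ρ ≤ volume.withDensity fun x => ENNReal.ofReal
      (J * Real.exp (-‖x - (k : ℝ) • h‖ ^ 2 / (2 * k))) := by
    refine (expTilt_sumLaw_le_of_le_gaussian hindep hident hsub hk hν h).trans (withDensity_mono ?_)
    exact Eventually.of_forall fun x => ENNReal.ofReal_le_ofReal (by gcongr)
  have m1 : Integrable (fun x => ‖x‖) ρ := by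
    simpa using integrable_norm_pow_expTilt hint h 1
  have m2 := integrable_norm_pow_expTilt hint h 2
  obtain ⟨m4, hm4⟩ := integral_norm_pow_four_le_of_le_gaussian hJ0 hk0 _ hρ2
  obtain ⟨t4, ht4⟩ := integrable_symmetrization_norm_pow (by norm_num) _ m4
  have ht4' : ∫ x, ‖x‖ ^ 4 ∂(symmetrization ρ) ≤ B :=
    ht4.trans (mul_le_mul_of_nonneg_left hm4 (by positivity))
  have hle24 : ∀ x : EuclideanSpace ℝ (Fin d), ‖x‖ ^ 2 ≤ 1 + ‖x‖ ^ 4 := fun x => by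
    nlinarith [sq_nonneg (‖x‖ ^ 2 - 1)]
  have i14 : Integrable (fun x => 1 + ‖x‖ ^ 4) (symmetrization ρ) := (integrable_const _).add t4
  have t2 : Integrable (fun x => ‖x‖ ^ 2) (symmetrization ρ) :=
    i14.mono' (by fun_prop) (Eventually.of_forall fun x => by
      rw [Real.norm_of_nonneg (by positivity)]; exact hle24 x)
  have ht2 : ∫ x, ‖x‖ ^ 2 ∂(symmetrization ρ) ≤ 1 + B := by
    refine (integral_mono t2 i14 hle24).trans ?_
    rw [integral_add (integrable_const _) t4]
    simpa using ht4'
  have hcos : cosTransform (symmetrization ρ) = fun t => ‖charFun ρ t‖ ^ 2 :=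
    funext fun t => (sq_norm_charFun_eq_integral_cos ρ t).symm
  obtain ⟨hi, hI⟩ := integral_sq_charFun_le ρ hJ0 hρ1
  rw [finrank_euclideanSpace_fin] at hI
  obtain ⟨hQ, hm⟩ := H (symmetrization ρ) inferInstance t2 ht2 t4 ht4'
    (fun t => by rw [hcos]; positivity) (by rwa [hcos]) (by rwa [hcos])
  have hcov := hessianMatrix_logLaplace_apply hint h
  have hhess := hessianMatrix_logLaplace_sumLaw hindep hident k h
  set M := hessianMatrix (logLaplace P (X 0)) h with hM
  have hquad : ∀ t, halfSecondMoment (symmetrization ρ) t =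
      t.ofLp ⬝ᵥ (((k : ℝ) • M).mulVec t.ofLp) := fun t => by
    rw [← hhess]
    exact halfSecondMoment_symmetrization m1 m2 hcov t
  have hherm : ((k : ℝ) • M).IsHermitian := by
    rw [← hhess]
    refine Matrix.IsHermitian.ext fun i j => ?_
    simp_rw [star_trivial, hcov, mul_comm]
  have hpd : ((k : ℝ) • M).PosDef :=
    posDef_of_le_dotProduct_mulVec hherm hc fun t => by rw [← hquad]; exact hQ t
  have hgauss : ∫ t, Real.exp (-halfSecondMoment (symmetrization ρ) t) =
      (Real.pi / k) ^ ((d : ℝ) / 2) * (Real.sqrt M.det)⁻¹ := by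
    simp_rw [hquad]
    rw [integral_exp_neg_dotProduct_mulVec hpd, Matrix.det_smul, Fintype.card_fin,
      Real.sqrt_mul (by positivity), Real.div_rpow Real.pi_pos.le hk0.le]
    have : Real.sqrt ((k : ℝ) ^ d) = (k : ℝ) ^ ((d : ℝ) / 2) := by
      rw [Real.sqrt_eq_rpow, ← Real.rpow_natCast, ← Real.rpow_mul hk0.le]
      congr 1; ring
    rw [this, ← div_eq_mul_inv, div_div]
  have hn0 : 0 < (n : ℝ) := by
    have : 0 < n := by omega
    exact_mod_cast this
  have hm1 : 1 ≤ (n : ℝ) / (2 * k) := by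
    rw [one_le_div (by positivity)]
    exact_mod_cast hn
  have hbound := hm _ hm1
  rw [hgauss, hcos, finrank_euclideanSpace_fin] at hbound
  obtain ⟨h1, -⟩ := expTilt_sumLaw_le_integral_rpow hindep hident hsub hk hn h hi
  refine h1.trans (ofReal_smul_le_ofReal_smul ?_ _)
  set m : ℝ := (n : ℝ) / (2 * k) with hmdef
  have hm0 : 0 < m := by linarith
  set D : ℝ := (Real.sqrt M.det)⁻¹
  set I := ∫ t, (‖charFun ρ t‖ ^ 2) ^ m
  -- `(2π)^(-d) m^(-d/2) (π/k)^(d/2) = (2πn)^(-d/2)`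
  have hconst : ((2 * Real.pi) ^ d)⁻¹ = (2 * Real.pi * n) ^ (-(d : ℝ) / 2) *
      ((k / Real.pi) ^ ((d : ℝ) / 2) * m ^ ((d : ℝ) / 2)) := by
    have e1 : (k / Real.pi) * m = (2 * Real.pi * n) * ((2 * Real.pi) ^ (2 : ℝ))⁻¹ := by
      rw [hmdef, Real.rpow_two]; field_simp
    rw [← Real.mul_rpow (by positivity) hm0.le, e1,
      Real.mul_rpow (x := 2 * Real.pi * n) (by positivity) (by positivity),
      ← mul_assoc, ← Real.rpow_add (by positivity), neg_div, neg_add_cancel, Real.rpow_zero,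
      one_mul, Real.inv_rpow (by positivity), ← Real.rpow_mul (by positivity),
      mul_div_cancel₀ _ (two_ne_zero' ℝ), Real.rpow_natCast]
  have hkpi : (k / Real.pi : ℝ) ^ ((d : ℝ) / 2) * (Real.pi / k) ^ ((d : ℝ) / 2) = 1 := by
    rw [← Real.mul_rpow (by positivity) (by positivity),
      show (k / Real.pi : ℝ) * (Real.pi / k) = 1 by field_simp, Real.one_rpow]
  calc ((2 * Real.pi) ^ d)⁻¹ * I
      = (2 * Real.pi * n) ^ (-(d : ℝ) / 2) * ((k / Real.pi) ^ ((d : ℝ) / 2) *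
          (m ^ ((d : ℝ) / 2) * I)) := by rw [hconst]; ring
    _ ≤ (2 * Real.pi * n) ^ (-(d : ℝ) / 2) * ((k / Real.pi) ^ ((d : ℝ) / 2) *
          ((Real.pi / k) ^ ((d : ℝ) / 2) * D + e m)) := by gcongr
    _ = _ := by
        rw [mul_add ((k / Real.pi : ℝ) ^ _), ← mul_assoc ((k / Real.pi : ℝ) ^ _), hkpi, one_mul]

end LocalLimit

/-! ### From the determinants to the densities -/

section Sufficiency

open Module
open scoped ENNReal RealInnerProductSpace

variable {d : ℕ} {Ω : Type*} [MeasurableSpace Ω] {P : Measure Ω} [IsProbabilityMeasure P]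
  {X : ℕ → Ω → EuclideanSpace ℝ (Fin d)}

theorem tsallisInf_normalizedSum_le_iff (hident : ∀ i, IdentDistrib (X i) (X 0) P P) {n : ℕ}
    (hn : n ≠ 0) {c : ℝ} (hc : 0 ≤ c) :
    tsallisInf (P.map (normalizedSum X n)) ≤ ((c - 1 : ℝ) : EReal) ↔
      sumLaw P X n ≤ volume.withDensity fun x => ENNReal.ofReal
        (c * (2 * Real.pi * n) ^ (-(d : ℝ) / 2) * Real.exp (-‖x‖ ^ 2 / (2 * n))) := by
  have := isProbabilityMeasure_sumLaw hident n
  have : IsProbabilityMeasure ((sumLaw P X n).map fun x => (Real.sqrt n)⁻¹ • x) :=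
    Measure.isProbabilityMeasure_map (by fun_prop)
  rw [map_normalizedSum hident, tsallisInf_le_iff hc,
    map_sqrt_smul_le_iff (Nat.cast_pos.2 (Nat.pos_of_ne_zero hn))]

/-- For tilts with `A(h)` small, the local limit bound applies; for the other ones the factor
`exp (n A(h))` in the bound to be proved beats the crude bound `C exp (k A(h))`. -/
theorem eventually_sumLaw_le_gaussian (hindep : iIndepFun X P)
    (hident : ∀ i, IdentDistrib (X i) (X 0) P P) (hsub : StrictlySubGaussian P (X 0))
    {k : ℕ} (hk : k ≠ 0) {C : ℝ} (hC : 0 ≤ C)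
    (hν : sumLaw P X k ≤ volume.withDensity fun x => ENNReal.ofReal
      (C * Real.exp (-‖x‖ ^ 2 / (2 * k))))
    (hdet : Tendsto (fun t => (hessianMatrix (logLaplace P (X 0)) t).det)
      (comap (gaussGap P (X 0)) (𝓝 0)) (𝓝 1)) {ε : ℝ} (hε : 0 < ε) :
    ∀ᶠ n : ℕ in atTop, sumLaw P X n ≤ volume.withDensity fun x => ENNReal.ofReal
      ((1 + ε) * (2 * Real.pi * n) ^ (-(d : ℝ) / 2) * Real.exp (-‖x‖ ^ 2 / (2 * n))) := by
  obtain ⟨err, herr, H⟩ := exists_uniform_local_limit_bound hindep hident hsub hk hC hν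
  have hD : Tendsto (fun t => (Real.sqrt (hessianMatrix (logLaplace P (X 0)) t).det)⁻¹)
      (comap (gaussGap P (X 0)) (𝓝 0)) (𝓝 1) := by
    have := (hdet.sqrt).inv₀ (by simp)
    simpa using this
  have hev := hD.eventually (gt_mem_nhds (show (1 : ℝ) < 1 + ε / 2 by linarith))
  rw [eventually_comap, Metric.eventually_nhds_iff] at hev
  obtain ⟨δ, hδ, hδ'⟩ := hev
  set δ' := min δ 1
  have hδ'0 : 0 < δ' := lt_min hδ one_pos
  have hlim : Tendsto (fun n : ℕ => C * (2 * Real.pi) ^ ((d : ℝ) / 2) *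
      ((n : ℝ) ^ ((d : ℝ) / 2) * Real.exp (-δ' * n))) atTop (𝓝 0) := by
    have := ((tendsto_rpow_mul_exp_neg_mul_atTop_nhds_zero ((d : ℝ) / 2) δ' hδ'0).comp
      tendsto_natCast_atTop_atTop).const_mul (C * (2 * Real.pi) ^ ((d : ℝ) / 2))
    simpa using this
  filter_upwards [herr.eventually (gt_mem_nhds (half_pos hε)),
    hlim.eventually (gt_mem_nhds (Real.exp_pos (-δ' * k))), eventually_ge_atTop (2 * k)]
    with n hn1 hn2 hn
  have hn0 : n ≠ 0 := by omega
  have hnpos : 0 < (n : ℝ) := Nat.cast_pos.2 (Nat.pos_of_ne_zero hn0)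
  have hpn := isProbabilityMeasure_sumLaw hident n
  refine le_gaussian_of_forall_expTilt_le (integrable_exp_sumLaw hindep hident hsub n) hnpos
    fun h => ?_
  rw [mul_sq_norm_sub_logLaplace_sumLaw hindep hident]
  have hA : 0 ≤ gaussGap P (X 0) h := (hsub h).2
  have hpow : 0 < (2 * Real.pi * n) ^ (-(d : ℝ) / 2) := by positivity
  rcases lt_or_ge (gaussGap P (X 0) h) δ' with hlt | hge
  · refine (H h (hlt.le.trans (min_le_right _ _)) n hn).trans (ofReal_smul_le_ofReal_smul ?_ _)
    have h1 := hδ' (y := gaussGap P (X 0) h)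
      (by rw [Real.dist_eq, sub_zero, abs_of_nonneg hA]; exact hlt.trans_le (min_le_left _ _)) h rfl
    have h2 : 1 ≤ Real.exp (n * gaussGap P (X 0) h) := Real.one_le_exp (by positivity)
    calc (2 * Real.pi * n) ^ (-(d : ℝ) / 2) *
          ((Real.sqrt (hessianMatrix (logLaplace P (X 0)) h).det)⁻¹ + err n)
        ≤ (2 * Real.pi * n) ^ (-(d : ℝ) / 2) * (1 + ε) :=
          mul_le_mul_of_nonneg_left (by linarith) hpow.le
      _ = (1 + ε) * (2 * Real.pi * n) ^ (-(d : ℝ) / 2) * 1 := by ring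
      _ ≤ _ := by gcongr
  · refine (expTilt_sumLaw_le_of_two_mul_le hindep hident hsub hk hC hν hn h).trans
      (ofReal_smul_le_ofReal_smul ?_ _)
    have hkn : (k : ℝ) ≤ n := by
      have : k ≤ n := by omega
      exact_mod_cast this
    have h1 : C ≤ (2 * Real.pi * n) ^ (-(d : ℝ) / 2) * Real.exp (δ' * n - δ' * k) := by
      have e1 : (2 * Real.pi) ^ ((d : ℝ) / 2) * (n : ℝ) ^ ((d : ℝ) / 2) =
          ((2 * Real.pi * n) ^ (-(d : ℝ) / 2))⁻¹ := by
        rw [← Real.mul_rpow (by positivity) hnpos.le, ← Real.rpow_neg (by positivity), neg_div,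
          neg_neg]
      have e2 : C * ((2 * Real.pi * n) ^ (-(d : ℝ) / 2))⁻¹ ≤ Real.exp (δ' * n - δ' * k) := by
        rw [← e1]
        have e3 : Real.exp (δ' * n - δ' * k) = Real.exp (-δ' * k) * Real.exp (δ' * n) := by
          rw [← Real.exp_add]; ring_nf
        have e4 : Real.exp (-δ' * n) * Real.exp (δ' * n) = 1 := by
          rw [← Real.exp_add]; simp
        calc C * ((2 * Real.pi) ^ ((d : ℝ) / 2) * (n : ℝ) ^ ((d : ℝ) / 2))
            = C * (2 * Real.pi) ^ ((d : ℝ) / 2) *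
              ((n : ℝ) ^ ((d : ℝ) / 2) * Real.exp (-δ' * n)) * Real.exp (δ' * n) := by
              linear_combination -(C * (2 * Real.pi) ^ ((d : ℝ) / 2) * (n : ℝ) ^ ((d : ℝ) / 2)) * e4
          _ ≤ Real.exp (-δ' * k) * Real.exp (δ' * n) := by gcongr
          _ = _ := e3.symm
      rwa [mul_inv_le_iff₀ hpow, mul_comm (Real.exp _)] at e2
    calc C * Real.exp (k * gaussGap P (X 0) h)
        ≤ (2 * Real.pi * n) ^ (-(d : ℝ) / 2) * Real.exp (δ' * n - δ' * k) *
          Real.exp (k * gaussGap P (X 0) h) := by gcongr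
      _ = (2 * Real.pi * n) ^ (-(d : ℝ) / 2) *
          Real.exp (δ' * n - δ' * k + k * gaussGap P (X 0) h) := by rw [mul_assoc, ← Real.exp_add]
      _ ≤ (2 * Real.pi * n) ^ (-(d : ℝ) / 2) * Real.exp (n * gaussGap P (X 0) h) := by
          gcongr
          nlinarith
      _ ≤ (1 + ε) * ((2 * Real.pi * n) ^ (-(d : ℝ) / 2) * Real.exp (n * gaussGap P (X 0) h)) :=
          le_mul_of_one_le_left (by positivity) (by linarith)
      _ = _ := by ring

end Sufficiency

/-! ### Probability measures dominated by a multiple of a Gaussian -/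

section Necessity

open Module
open scoped ENNReal RealInnerProductSpace

variable {d : ℕ} {Ω : Type*} [MeasurableSpace Ω] {P : Measure Ω} [IsProbabilityMeasure P]
  {X : ℕ → Ω → EuclideanSpace ℝ (Fin d)}

/-- The standard Gaussian measure as the measure with density `φ`. -/
def normalMeasure (d : ℕ) : Measure (EuclideanSpace ℝ (Fin d)) :=
  volume.withDensity fun x => ENNReal.ofReal (stdNormalDensity d x)

theorem integral_normalMeasure (f : EuclideanSpace ℝ (Fin d) → ℝ) :
    ∫ x, f x ∂(normalMeasure d) = ∫ x, stdNormalDensity d x * f x := by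
  rw [normalMeasure, integral_withDensity_eq_integral_toReal_smul
    (continuous_stdNormalDensity.measurable.ennreal_ofReal)
    (Eventually.of_forall fun x => ENNReal.ofReal_lt_top)]
  simp_rw [ENNReal.toReal_ofReal (stdNormalDensity_pos _).le, smul_eq_mul]

theorem integrable_normalMeasure_iff (f : EuclideanSpace ℝ (Fin d) → ℝ) :
    Integrable f (normalMeasure d) ↔ Integrable fun x => stdNormalDensity d x * f x := by
  rw [normalMeasure, integrable_withDensity_iff_integrable_smul'
    (continuous_stdNormalDensity.measurable.ennreal_ofReal)
    (Eventually.of_forall fun x => ENNReal.ofReal_lt_top)]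
  simp_rw [ENNReal.toReal_ofReal (stdNormalDensity_pos _).le, smul_eq_mul]

instance : IsProbabilityMeasure (normalMeasure d) := by
  refine ⟨?_⟩
  rw [normalMeasure, withDensity_apply _ MeasurableSet.univ, Measure.restrict_univ,
    ← ofReal_integral_eq_lintegral_ofReal integrable_stdNormalDensity
      (Eventually.of_forall fun x => (stdNormalDensity_pos x).le),
    integral_stdNormalDensity, ENNReal.ofReal_one]

theorem stdNormalDensity_mul_exp_inner (t x : EuclideanSpace ℝ (Fin d)) :
    stdNormalDensity d x * Real.exp ⟪t, x⟫ =
      Real.exp (‖t‖ ^ 2 / 2) * stdNormalDensity d (x - t) := by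
  have : Real.exp (-‖x‖ ^ 2 / 2) * Real.exp ⟪t, x⟫ =
      Real.exp (‖t‖ ^ 2 / 2) * Real.exp (-‖x - t‖ ^ 2 / 2) := by
    rw [← Real.exp_add, ← Real.exp_add, norm_sub_sq_real, real_inner_comm t x]
    ring_nf
  unfold stdNormalDensity
  linear_combination (2 * Real.pi) ^ (-(d : ℝ) / 2) * this

theorem integrable_exp_normalMeasure (t : EuclideanSpace ℝ (Fin d)) :
    Integrable (fun x => Real.exp ⟪t, x⟫) (normalMeasure d) := by
  rw [integrable_normalMeasure_iff]
  simp_rw [stdNormalDensity_mul_exp_inner]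
  exact (integrable_stdNormalDensity.comp_sub_right t).const_mul _

theorem logLaplace_normalMeasure (t : EuclideanSpace ℝ (Fin d)) :
    logLaplace (normalMeasure d) id t = ‖t‖ ^ 2 / 2 := by
  rw [logLaplace, integral_normalMeasure]
  simp_rw [id, stdNormalDensity_mul_exp_inner]
  rw [integral_const_mul, integral_sub_right_eq_self, integral_stdNormalDensity, mul_one,
    Real.log_exp]

theorem integral_coord_normalMeasure (i : Fin d) : ∫ x, x i ∂(normalMeasure d) = 0 := by
  rw [integral_normalMeasure]
  have h := integral_neg_eq_self (fun x : EuclideanSpace ℝ (Fin d) => stdNormalDensity d x * x i)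
    volume
  have e : ∀ x : EuclideanSpace ℝ (Fin d), stdNormalDensity d (-x) * (-x) i =
      -(stdNormalDensity d x * x i) := by
    intro x
    simp [stdNormalDensity]
  simp_rw [e, integral_neg] at h
  linarith

/-- The covariance matrix of the Gaussian measure is the Hessian of `|t|²/2`. -/
theorem integral_coord_mul_coord_normalMeasure (i j : Fin d) :
    ∫ x, x i * x j ∂(normalMeasure d) = (1 : Matrix (Fin d) (Fin d) ℝ) i j := by
  have h1 := hessianMatrix_logLaplace_apply (integrable_exp_normalMeasure (d := d)) 0 i j
  have h2 := hessianMatrix_sq_norm_sub_logLaplace (integrable_exp_normalMeasure (d := d)) 0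
  have h3 : expTilt (normalMeasure d) 0 = normalMeasure d := by
    rw [expTilt]
    simp
  have h4 : hessianMatrix (fun s : EuclideanSpace ℝ (Fin d) =>
      ‖s‖ ^ 2 / 2 - logLaplace (normalMeasure d) id s) 0 = 0 := by
    simp_rw [logLaplace_normalMeasure, sub_self]
    ext i j
    simp [hessianMatrix]
  rw [h4] at h2
  rw [h3, integral_coord_normalMeasure, zero_mul, sub_zero] at h1
  rw [← h1, ← sub_eq_zero.1 h2.symm]

theorem integrable_norm_pow_normalMeasure (k : ℕ) :
    Integrable (fun x => ‖x‖ ^ k) (normalMeasure d) := by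
  simpa using integrable_norm_pow_mul_exp (integrable_exp_normalMeasure (d := d)) k 0

/-- The integral of `(s - g)²` against the positive measure `a γ - ρ` is nonnegative, which bounds
`∫ g dρ` from below. -/
theorem le_integral_of_le_smul {α : Type*} [MeasurableSpace α] {ρ γ : Measure α}
    [IsProbabilityMeasure ρ] [IsProbabilityMeasure γ] {a s : ℝ} (ha : 0 ≤ a) (hs : 0 < s)
    (hρ : ρ ≤ ENNReal.ofReal a • γ) {g : α → ℝ} (hg : Integrable g γ)
    (hg2 : Integrable (fun x => g x ^ 2) γ) :
    a * ∫ x, g x ∂γ - (a - 1) * s / 2 - a * (∫ x, g x ^ 2 ∂γ) / (2 * s) ≤ ∫ x, g x ∂ρ := by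
  have hint : ∀ {f : α → ℝ}, Integrable f γ → Integrable f ρ := fun hf =>
    (hf.smul_measure ENNReal.ofReal_ne_top).mono_measure hρ
  have hF : Integrable (fun x => (s ^ 2 - 2 * s * g x) + g x ^ 2) γ :=
    ((integrable_const (s ^ 2)).sub (hg.const_mul (2 * s))).add hg2
  have hval : ∀ (μ : Measure α) [IsProbabilityMeasure μ], Integrable g μ →
      Integrable (fun x => g x ^ 2) μ → ∫ x, ((s ^ 2 - 2 * s * g x) + g x ^ 2) ∂μ =
        s ^ 2 - 2 * s * ∫ x, g x ∂μ + ∫ x, g x ^ 2 ∂μ := by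
    intro μ _ h1 h2
    have h3 : Integrable (fun x => s ^ 2 - 2 * s * g x) μ :=
      (integrable_const (s ^ 2)).sub (h1.const_mul (2 * s))
    rw [integral_add h3 h2, integral_sub (integrable_const _) (h1.const_mul _), integral_const_mul]
    simp
  have hle : ∫ x, ((s ^ 2 - 2 * s * g x) + g x ^ 2) ∂ρ ≤
      a * ∫ x, ((s ^ 2 - 2 * s * g x) + g x ^ 2) ∂γ := by
    have h1 := integral_mono_measure hρ (Eventually.of_forall fun x => by
      show 0 ≤ (s ^ 2 - 2 * s * g x) + g x ^ 2
      nlinarith [sq_nonneg (s - g x)]) (hF.smul_measure ENNReal.ofReal_ne_top)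
    rwa [integral_smul_measure, ENNReal.toReal_ofReal ha, smul_eq_mul] at h1
  rw [hval ρ (hint hg) (hint hg2), hval γ hg hg2] at hle
  have hnn : 0 ≤ ∫ x, g x ^ 2 ∂ρ := integral_nonneg fun x => sq_nonneg _
  have h2 : a * (∫ x, g x ^ 2 ∂γ) / (2 * s) * (2 * s) = a * ∫ x, g x ^ 2 ∂γ := by
    field_simp
  have h3 : (a * ∫ x, g x ∂γ - (a - 1) * s / 2 - a * (∫ x, g x ^ 2 ∂γ) / (2 * s)) * (2 * s) ≤
      (∫ x, g x ∂ρ) * (2 * s) := by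
    rw [sub_mul, h2]
    nlinarith
  exact le_of_mul_le_mul_right h3 (by positivity)

/-- Two probability measures with `ρ ≤ a γ` and `a` close to `1` have almost equal integrals,
uniformly over the functions with bounded second moment. -/
theorem abs_integral_sub_le_of_le_smul {α : Type*} [MeasurableSpace α] {γ : Measure α}
    [IsProbabilityMeasure γ] (B : ℝ) {η : ℝ} (hη : 0 < η) :
    ∃ δ : ℝ, 0 < δ ∧ ∀ (ρ : Measure α) (a : ℝ), IsProbabilityMeasure ρ → 1 ≤ a → a ≤ 1 + δ →
      ρ ≤ ENNReal.ofReal a • γ → ∀ g : α → ℝ, Integrable g γ → Integrable (fun x => g x ^ 2) γ →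
      ∫ x, g x ^ 2 ∂γ ≤ B → |∫ x, g x ∂ρ - ∫ x, g x ∂γ| ≤ η := by
  set B' := |B| + 1
  have hB' : 0 < B' := by positivity
  -- with this `s` the term in `∫ g²` is at most `η / 2`; then `a - 1` is taken small against `s`
  set s : ℝ := 2 * B' / η
  have hs : 0 < s := by positivity
  refine ⟨min 1 (η / (s + 2 * B')), by positivity, fun ρ a hρ h1a ha hle g hg hg2 hgB => ?_⟩
  have ha2 : a ≤ 2 := by linarith [min_le_left 1 (η / (s + 2 * B'))]
  have haη : (a - 1) * (s + 2 * B') ≤ η := by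
    rw [← le_div_iff₀ (by positivity)]
    linarith [min_le_right 1 (η / (s + 2 * B'))]
  have hBs : a * (∫ x, g x ^ 2 ∂γ) / (2 * s) ≤ η / 2 := by
    have hI : ∫ x, g x ^ 2 ∂γ ≤ B' := hgB.trans ((le_abs_self B).trans (by simp [B']))
    calc a * (∫ x, g x ^ 2 ∂γ) / (2 * s) ≤ 2 * B' / (2 * s) := by
          gcongr
      _ = η / 2 := by simp only [s]; field_simp
  have hgγ : |∫ x, g x ∂γ| ≤ B' := by
    refine abs_integral_le_integral_abs.trans ?_
    have : ∫ x, |g x| ∂γ ≤ ∫ x, (1 + g x ^ 2) ∂γ := by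
      refine integral_mono hg.abs ((integrable_const _).add hg2) fun x => ?_
      show |g x| ≤ 1 + g x ^ 2
      rw [← sq_abs]
      nlinarith [sq_nonneg (|g x| - 1)]
    rw [integral_add (integrable_const _) hg2] at this
    simp only [integral_const, probReal_univ, smul_eq_mul, mul_one] at this
    have := le_abs_self B
    simp only [B']
    linarith
  have l1 := le_integral_of_le_smul (by linarith) hs hle hg hg2
  have l2 := le_integral_of_le_smul (g := fun x => -g x) (by linarith) hs hle hg.neg
    (by simpa using hg2)
  simp only [integral_neg, neg_sq] at l2
  have h3 := abs_le.1 hgγ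
  have h4 : (a - 1) * (∫ x, g x ∂γ) ≤ (a - 1) * B' :=
    mul_le_mul_of_nonneg_left h3.2 (by linarith)
  have h5 : (a - 1) * -B' ≤ (a - 1) * (∫ x, g x ∂γ) :=
    mul_le_mul_of_nonneg_left h3.1 (by linarith)
  rw [abs_le]
  constructor <;> linarith

end Necessity

/-! ### From the densities to the Hessians -/

section HessianConvergence

open Module
open scoped ENNReal RealInnerProductSpace

variable {d : ℕ} {Ω : Type*} [MeasurableSpace Ω] {P : Measure Ω} [IsProbabilityMeasure P]
  {X : ℕ → Ω → EuclideanSpace ℝ (Fin d)}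

/-- The tilted law of a sum of `n` summands, recentred at `n h` and rescaled by `√n`. -/
def rescaledTilt (P : Measure Ω) (X : ℕ → Ω → EuclideanSpace ℝ (Fin d)) (n : ℕ)
    (h : EuclideanSpace ℝ (Fin d)) : Measure (EuclideanSpace ℝ (Fin d)) :=
  (expTilt (sumLaw P X n) h).map fun x => (Real.sqrt n)⁻¹ • (x - (n : ℝ) • h)

theorem map_sub_withDensity_volume (g : EuclideanSpace ℝ (Fin d) → ℝ≥0∞)
    (v : EuclideanSpace ℝ (Fin d)) :
    (volume.withDensity fun x => g (x - v)).map (fun x => x - v) = volume.withDensity g := by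
  have hm : Measurable fun x : EuclideanSpace ℝ (Fin d) => x - v := by fun_prop
  ext S hS
  rw [Measure.map_apply hm hS, withDensity_apply _ (hm hS), withDensity_apply _ hS,
    ← lintegral_indicator (hm hS), ← lintegral_indicator hS,
    ← lintegral_sub_right_eq_self (S.indicator g) v]
  rfl

/-- After the rescaling, the Gaussian bound centred at `n h` is a multiple of the standard Gaussian
measure. -/
theorem rescaledTilt_le (hindep : iIndepFun X P)
    (hident : ∀ i, IdentDistrib (X i) (X 0) P P) (hsub : StrictlySubGaussian P (X 0))
    {n : ℕ} (hn : n ≠ 0) {c : ℝ} (hc : 0 ≤ c)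
    (hν : sumLaw P X n ≤ volume.withDensity fun x => ENNReal.ofReal
      (c * (2 * Real.pi * n) ^ (-(d : ℝ) / 2) * Real.exp (-‖x‖ ^ 2 / (2 * n))))
    (h : EuclideanSpace ℝ (Fin d)) :
    rescaledTilt P X n h ≤
      ENNReal.ofReal (c * Real.exp (n * gaussGap P (X 0) h)) • normalMeasure d := by
  have hm : Measurable fun x : EuclideanSpace ℝ (Fin d) => x - (n : ℝ) • h := by fun_prop
  have h1 := Measure.map_mono (expTilt_sumLaw_le_of_le_gaussian hindep hident hsub hn hν h) hm
  rw [map_sub_withDensity_volume (fun x => ENNReal.ofReal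
    (c * (2 * Real.pi * n) ^ (-(d : ℝ) / 2) * Real.exp (n * gaussGap P (X 0) h) *
      Real.exp (-‖x‖ ^ 2 / (2 * n))))] at h1
  have h2 := (map_sqrt_smul_le_iff (Nat.cast_pos.2 (Nat.pos_of_ne_zero hn))
    (c * Real.exp (n * gaussGap P (X 0) h))).2
    (h1.trans_eq (by congr 1; ext x; congr 1; ring))
  have e : rescaledTilt P X n h = ((expTilt (sumLaw P X n) h).map fun x => x - (n : ℝ) • h).map
      fun x => (Real.sqrt n)⁻¹ • x := by
    rw [Measure.map_map (by fun_prop) hm]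
    rfl
  rw [e]
  refine h2.trans_eq ?_
  rw [normalMeasure, ← withDensity_smul _ (continuous_stdNormalDensity.measurable.ennreal_ofReal)]
  congr 1
  ext x
  rw [Pi.smul_apply, smul_eq_mul, ENNReal.ofReal_mul (by positivity)]

/-- `K''(h)` is the covariance matrix of the rescaled tilted law. The recentring at `n h`, which need
not be the mean, does not change the covariances. -/
theorem hessianMatrix_logLaplace_eq_rescaledTilt (hindep : iIndepFun X P)
    (hident : ∀ i, IdentDistrib (X i) (X 0) P P) (hsub : StrictlySubGaussian P (X 0))
    {n : ℕ} (hn : n ≠ 0) (h : EuclideanSpace ℝ (Fin d)) (i j : Fin d) :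
    hessianMatrix (logLaplace P (X 0)) h i j = (∫ x, x i * x j ∂(rescaledTilt P X n h)) -
      (∫ x, x i ∂(rescaledTilt P X n h)) * ∫ x, x j ∂(rescaledTilt P X n h) := by
  have hpn := isProbabilityMeasure_sumLaw (P := P) (X := X) hident n
  have hp := isProbabilityMeasure_expTilt_sumLaw hindep hident hsub n h
  have hint := integrable_exp_sumLaw hindep hident hsub n
  have hcov := hessianMatrix_logLaplace_apply hint h i j
  rw [hessianMatrix_logLaplace_sumLaw hindep hident, Matrix.smul_apply, smul_eq_mul] at hcov
  set ρ := expTilt (sumLaw P X n) h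
  have hn0 : 0 < (n : ℝ) := Nat.cast_pos.2 (Nat.pos_of_ne_zero hn)
  have m1 : Integrable (fun x => ‖x‖) ρ := by
    simpa using integrable_norm_pow_expTilt hint h 1
  have m2 : Integrable (fun x => ‖x‖ ^ 2) ρ := integrable_norm_pow_expTilt hint h 2
  have hi := fun l => integrable_coord m1 l
  have hij := integrable_coord_mul_coord m2 i j
  have e1 : ∀ l, ∫ x, x l ∂(rescaledTilt P X n h) =
      (Real.sqrt n)⁻¹ * ((∫ x, x l ∂ρ) - n * h l) := by
    intro l
    rw [rescaledTilt, integral_map (by fun_prop) (by fun_prop)]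
    simp only [PiLp.smul_apply, PiLp.sub_apply, smul_eq_mul]
    rw [integral_const_mul, integral_sub (hi l) (integrable_const _)]
    simp
  have e2 : ∫ x, x i * x j ∂(rescaledTilt P X n h) =
      ((Real.sqrt n)⁻¹ * (Real.sqrt n)⁻¹) * ((∫ x, x i * x j ∂ρ) - n * h j * (∫ x, x i ∂ρ) -
        (n * h i * (∫ x, x j ∂ρ) - n * h i * (n * h j))) := by
    rw [rescaledTilt, integral_map (by fun_prop) (by fun_prop)]
    simp only [PiLp.smul_apply, PiLp.sub_apply, smul_eq_mul]
    have e : ∀ x : EuclideanSpace ℝ (Fin d),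
        (Real.sqrt n)⁻¹ * (x i - n * h i) * ((Real.sqrt n)⁻¹ * (x j - n * h j)) =
        ((Real.sqrt n)⁻¹ * (Real.sqrt n)⁻¹) * ((x i * x j - n * h j * x i) -
          (n * h i * x j - n * h i * (n * h j))) := fun x => by ring
    simp_rw [e]
    have j1 : Integrable (fun x => x i * x j - n * h j * x i) ρ := hij.sub ((hi i).const_mul _)
    have j2 : Integrable (fun x => n * h i * x j - n * h i * (n * h j)) ρ :=
      ((hi j).const_mul _).sub (integrable_const _)
    rw [integral_const_mul, integral_sub j1 j2, integral_sub hij ((hi i).const_mul _),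
      integral_sub ((hi j).const_mul _) (integrable_const _), integral_const_mul,
      integral_const_mul]
    simp
  rw [e1, e1, e2]
  have hs : (Real.sqrt n)⁻¹ * (Real.sqrt n)⁻¹ = (n : ℝ)⁻¹ := by
    rw [← mul_inv, Real.mul_self_sqrt hn0.le]
  have hK : hessianMatrix (logLaplace P (X 0)) h i j =
      (n : ℝ)⁻¹ * ((∫ x, x i * x j ∂ρ) - (∫ x, x i ∂ρ) * ∫ x, x j ∂ρ) := by
    rw [← hcov]; field_simp
  rw [hK, ← hs]
  ring

/-- If `p_n ≤ (1 + ε) φ`, then the rescaled tilted law of the sum has a density at most `a φ` with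
`a` close to `1` as soon as `n A(h)` is small. Hence its covariance matrix, which is `K''(h)`, is
close to the identity. -/
theorem tendsto_hessianMatrix_logLaplace (hindep : iIndepFun X P)
    (hident : ∀ i, IdentDistrib (X i) (X 0) P P) (hsub : StrictlySubGaussian P (X 0))
    (hν : ∀ ε : ℝ, 0 < ε → ∃ n : ℕ, n ≠ 0 ∧
      sumLaw P X n ≤ volume.withDensity fun x => ENNReal.ofReal
        ((1 + ε) * (2 * Real.pi * n) ^ (-(d : ℝ) / 2) * Real.exp (-‖x‖ ^ 2 / (2 * n)))) :
    Tendsto (hessianMatrix (logLaplace P (X 0))) (comap (gaussGap P (X 0)) (𝓝 0)) (𝓝 1) := by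
  refine tendsto_pi_nhds.2 fun i => tendsto_pi_nhds.2 fun j => ?_
  rw [Metric.tendsto_nhds]
  intro ε hε
  set η : ℝ := min 1 (ε / 3) with hη
  have hηpos : 0 < η := by positivity
  obtain ⟨δ, hδ, H⟩ := abs_integral_sub_le_of_le_smul (γ := normalMeasure d)
    (∫ x, (1 + ‖x‖ ^ 4) ∂(normalMeasure d)) hηpos
  have hlim : Tendsto (fun r : ℝ => (1 + r) * Real.exp r) (𝓝[>] 0) (𝓝 1) := by
    have : Continuous fun r : ℝ => (1 + r) * Real.exp r := by fun_prop
    simpa using (this.tendsto 0).mono_left nhdsWithin_le_nhds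
  obtain ⟨r, hrδ, hr⟩ := ((hlim.eventually (gt_mem_nhds (show (1 : ℝ) < 1 + δ by linarith))).and
    self_mem_nhdsWithin).exists
  obtain ⟨n, hn, hle⟩ := hν r hr
  have hn0 : 0 < (n : ℝ) := Nat.cast_pos.2 (Nat.pos_of_ne_zero hn)
  rw [eventually_comap]
  filter_upwards [gt_mem_nhds (show (0 : ℝ) < r / n by positivity)] with y hy h hh
  subst hh
  have hA : 0 ≤ gaussGap P (X 0) h := (hsub h).2
  have hnA : n * gaussGap P (X 0) h ≤ r := by
    rw [lt_div_iff₀ hn0] at hy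
    linarith
  have hρ := rescaledTilt_le hindep hident hsub hn (by linarith) hle h
  set a := (1 + r) * Real.exp (n * gaussGap P (X 0) h) with ha
  have ha1 : 1 ≤ a := by
    have : 1 ≤ Real.exp (n * gaussGap P (X 0) h) := Real.one_le_exp (by positivity)
    nlinarith
  have haδ : a ≤ 1 + δ := by
    refine le_trans ?_ hrδ.le
    rw [ha]
    gcongr
  have hpt := isProbabilityMeasure_expTilt_sumLaw hindep hident hsub n h
  have hp : IsProbabilityMeasure (rescaledTilt P X n h) :=
    Measure.isProbabilityMeasure_map (by fun_prop)
  have g1 : Integrable (fun x => ‖x‖) (normalMeasure d) := by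
    simpa using integrable_norm_pow_normalMeasure (d := d) 1
  have g2 := integrable_norm_pow_normalMeasure (d := d) 2
  have g4 := integrable_norm_pow_normalMeasure (d := d) 4
  have g14 : Integrable (fun x => 1 + ‖x‖ ^ 4) (normalMeasure d) := (integrable_const _).add g4
  have key : ∀ g : EuclideanSpace ℝ (Fin d) → ℝ, Integrable g (normalMeasure d) → Continuous g →
      (∀ x, g x ^ 2 ≤ 1 + ‖x‖ ^ 4) →
      |∫ x, g x ∂(rescaledTilt P X n h) - ∫ x, g x ∂(normalMeasure d)| ≤ η := by
    intro g hg hgc hgle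
    have hg2 : Integrable (fun x => g x ^ 2) (normalMeasure d) :=
      g14.mono' (by fun_prop) (Eventually.of_forall fun x => by
        rw [Real.norm_of_nonneg (sq_nonneg _)]; exact hgle x)
    exact H _ a hp ha1 haδ hρ g hg hg2 (integral_mono hg2 g14 hgle)
  have hcoord : ∀ (x : EuclideanSpace ℝ (Fin d)) (l : Fin d), x l ^ 2 ≤ ‖x‖ ^ 2 := fun x l => by
    rw [← sq_abs]
    exact pow_le_pow_left₀ (abs_nonneg _) (PiLp.norm_apply_le x l) 2
  have k1 : ∀ l, |∫ x, x l ∂(rescaledTilt P X n h)| ≤ η := by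
    intro l
    have := key (fun x => x l) (integrable_coord g1 l) (by fun_prop) fun x => by
      have := hcoord x l
      nlinarith [sq_nonneg (‖x‖ ^ 2 - 1)]
    rwa [integral_coord_normalMeasure, sub_zero] at this
  have k2 := key (fun x => x i * x j) (integrable_coord_mul_coord g2 i j) (by fun_prop) fun x => by
    have := mul_le_mul (hcoord x i) (hcoord x j) (sq_nonneg _) (sq_nonneg _)
    calc (x i * x j) ^ 2 = x i ^ 2 * x j ^ 2 := by ring
      _ ≤ ‖x‖ ^ 2 * ‖x‖ ^ 2 := this
      _ = ‖x‖ ^ 4 := by ring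
      _ ≤ 1 + ‖x‖ ^ 4 := by linarith
  rw [integral_coord_mul_coord_normalMeasure] at k2
  rw [Real.dist_eq, hessianMatrix_logLaplace_eq_rescaledTilt hindep hident hsub hn]
  have k3 : |(∫ x, x i ∂(rescaledTilt P X n h)) * ∫ x, x j ∂(rescaledTilt P X n h)| ≤ η := by
    rw [abs_mul]
    calc _ ≤ η * 1 := mul_le_mul (k1 i) ((k1 j).trans (min_le_left _ _)) (abs_nonneg _) hηpos.le
      _ = η := mul_one η
  have hη3 : η ≤ ε / 3 := min_le_right _ _
  have k4 := abs_le.1 k2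
  have k5 := abs_le.1 k3
  rw [abs_lt]
  constructor <;> linarith

/-- A limit along `A(t) → 0` can be tested on the zeros of `A` and on the sequences that escape to
infinity, since bounded sequences have convergent subsequences. -/
theorem tendsto_comap_nhds_zero_iff {Y : Type*} [TopologicalSpace Y] [T1Space Y]
    {A : EuclideanSpace ℝ (Fin d) → ℝ} (hA : Continuous A) {F : EuclideanSpace ℝ (Fin d) → Y}
    (hF : Continuous F) (y : Y) :
    Tendsto F (comap A (𝓝 0)) (𝓝 y) ↔
      (∀ t, A t = 0 → F t = y) ∧
      ∀ t : ℕ → EuclideanSpace ℝ (Fin d), Tendsto (fun k => ‖t k‖) atTop atTop →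
        Tendsto (fun k => A (t k)) atTop (𝓝 0) → Tendsto (fun k => F (t k)) atTop (𝓝 y) := by
  constructor
  · intro h
    refine ⟨fun t ht => ?_, fun t _ ht => h.comp (tendsto_comap_iff.2 ht)⟩
    have h1 : Tendsto (fun _ : ℕ => t) atTop (comap A (𝓝 0)) := by
      rw [tendsto_comap_iff]
      have : A ∘ (fun _ : ℕ => t) = fun _ => 0 := funext fun _ => ht
      rw [this]
      exact tendsto_const_nhds
    exact tendsto_const_nhds_iff.1 (h.comp h1)
  · rintro ⟨h0, hinf⟩
    refine tendsto_of_seq_tendsto fun u hu => tendsto_of_subseq_tendsto fun ns hns => ?_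
    have hAu : Tendsto (fun k => A (u (ns k))) atTop (𝓝 0) := (tendsto_comap_iff.1 hu).comp hns
    by_cases hb : Tendsto (fun k => ‖u (ns k)‖) atTop atTop
    · exact ⟨id, hinf _ hb hAu⟩
    · rw [tendsto_atTop] at hb
      push Not at hb
      obtain ⟨R, hR⟩ := hb
      have hfr : ∃ᶠ k in atTop, u (ns k) ∈ Metric.closedBall (0 : EuclideanSpace ℝ (Fin d)) R := by
        refine hR.mono fun k hk => ?_
        rw [mem_closedBall_zero_iff]
        exact hk.le
      obtain ⟨x, -, ψ, hψ, hx⟩ := tendsto_subseq_of_frequently_bounded Metric.isBounded_closedBall hfr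
      have hAx : A x = 0 := tendsto_nhds_unique ((hA.tendsto x).comp hx) (hAu.comp hψ.tendsto_atTop)
      refine ⟨ψ, ?_⟩
      have := (hF.tendsto x).comp hx
      rwa [h0 x hAx] at this

theorem isProbabilityMeasure_map_normalizedSum (hident : ∀ i, IdentDistrib (X i) (X 0) P P)
    (n : ℕ) : IsProbabilityMeasure (P.map (normalizedSum X n)) := by
  have := isProbabilityMeasure_sumLaw hident n
  rw [map_normalizedSum hident]
  exact Measure.isProbabilityMeasure_map (by fun_prop)

theorem tendsto_tsallisInf_of_eventually_le (hident : ∀ i, IdentDistrib (X i) (X 0) P P)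
    (hν : ∀ ε : ℝ, 0 < ε → ∀ᶠ n : ℕ in atTop,
      sumLaw P X n ≤ volume.withDensity fun x => ENNReal.ofReal
        ((1 + ε) * (2 * Real.pi * n) ^ (-(d : ℝ) / 2) * Real.exp (-‖x‖ ^ 2 / (2 * n)))) :
    Tendsto (fun n => tsallisInf (P.map (normalizedSum X n))) atTop (𝓝 0) := by
  refine tendsto_order.2 ⟨fun b hb => Eventually.of_forall fun n => ?_, fun b hb => ?_⟩
  · have := isProbabilityMeasure_map_normalizedSum hident n
    exact hb.trans_le (tsallisInf_nonneg _)
  · obtain ⟨q, hq0, hqb⟩ := EReal.lt_iff_exists_real_btwn.1 hb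
    have hq : 0 < q := by exact_mod_cast hq0
    filter_upwards [hν q hq, eventually_ne_atTop 0] with n hn hn0
    have h := (tsallisInf_normalizedSum_le_iff hident hn0 (by linarith)).2 hn
    rw [add_sub_cancel_left] at h
    exact h.trans_lt hqb

theorem exists_le_of_tendsto_tsallisInf (hident : ∀ i, IdentDistrib (X i) (X 0) P P)
    (hT : Tendsto (fun n => tsallisInf (P.map (normalizedSum X n))) atTop (𝓝 0)) {ε : ℝ}
    (hε : 0 < ε) : ∃ n : ℕ, n ≠ 0 ∧
      sumLaw P X n ≤ volume.withDensity fun x => ENNReal.ofReal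
        ((1 + ε) * (2 * Real.pi * n) ^ (-(d : ℝ) / 2) * Real.exp (-‖x‖ ^ 2 / (2 * n))) := by
  have hε' : (0 : EReal) < (ε : EReal) := by exact_mod_cast hε
  obtain ⟨n, hn, hn0⟩ := ((hT.eventually (gt_mem_nhds hε')).and (eventually_ne_atTop 0)).exists
  refine ⟨n, hn0, (tsallisInf_normalizedSum_le_iff hident hn0 (by linarith)).1 ?_⟩
  rw [add_sub_cancel_left]
  exact hn.le

theorem exists_sumLaw_le_gaussian (hident : ∀ i, IdentDistrib (X i) (X 0) P P)
    (hfin : ∃ n₀ : ℕ, 1 ≤ n₀ ∧ tsallisInf (P.map (normalizedSum X n₀)) < ⊤) :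
    ∃ (k : ℕ) (C : ℝ), k ≠ 0 ∧ 0 ≤ C ∧ sumLaw P X k ≤ volume.withDensity fun x =>
      ENNReal.ofReal (C * Real.exp (-‖x‖ ^ 2 / (2 * k))) := by
  obtain ⟨k, hk, hlt⟩ := hfin
  obtain ⟨q, hq, -⟩ := EReal.lt_iff_exists_real_btwn.1 hlt
  have hk0 : k ≠ 0 := by omega
  have hle : tsallisInf (P.map (normalizedSum X k)) ≤ ((max 0 (q + 1) - 1 : ℝ) : EReal) :=
    hq.le.trans (EReal.coe_le_coe_iff.2 (by linarith [le_max_right 0 (q + 1)]))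
  exact ⟨k, max 0 (q + 1) * (2 * Real.pi * k) ^ (-(d : ℝ) / 2), hk0, by positivity,
    (tsallisInf_normalizedSum_le_iff hident hk0 (le_max_left _ _)).1 hle⟩

end HessianConvergence

end

/-! ### The equivalence of the three conditions -/

theorem theorem1p2 {d : ℕ} {Ω : Type*} [MeasurableSpace Ω] (P : Measure Ω)
    [IsProbabilityMeasure P] (X : ℕ → Ω → EuclideanSpace ℝ (Fin d))
    -- independent copies of the random vector `X 0`
    (hindep : iIndepFun X P) (hident : ∀ i, IdentDistrib (X i) (X 0) P P)
    -- mean zero and identity covariance matrix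
    (hL2 : MemLp (X 0) 2 P) (hmean : ∫ ω, X 0 ω ∂P = 0) (hcov : covMatrix P (X 0) = 1)
    -- `Z_n` has a density with finite `T_∞` for some `n`
    (hfin : ∃ n₀ : ℕ, 1 ≤ n₀ ∧ tsallisInf (P.map (normalizedSum X n₀)) < ⊤)
    (hsub : StrictlySubGaussian P (X 0)) :
    -- convergence holds if and only if a) and b) hold
    (Tendsto (fun n => tsallisInf (P.map (normalizedSum X n))) atTop (𝓝 0) ↔
      (∀ t, gaussGap P (X 0) t = 0 → hessianMatrix (gaussGap P (X 0)) t = 0) ∧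
      (∀ t : ℕ → EuclideanSpace ℝ (Fin d), Tendsto (fun k => ‖t k‖) atTop atTop →
        Tendsto (fun k => gaussGap P (X 0) (t k)) atTop (𝓝 0) →
        Tendsto (fun k => hessianMatrix (gaussGap P (X 0)) (t k)) atTop (𝓝 0))) ∧
    -- convergence holds if and only if `det K''(t) → 1` as `A(t) → 0`
    (Tendsto (fun n => tsallisInf (P.map (normalizedSum X n))) atTop (𝓝 0) ↔
      Tendsto (fun t => (hessianMatrix (logLaplace P (X 0)) t).det)
        (comap (gaussGap P (X 0)) (𝓝 0)) (𝓝 1)) := by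
  obtain ⟨k, C, hk, hC, hν⟩ := exists_sumLaw_le_gaussian hident hfin
  have hTS : Tendsto (fun n => tsallisInf (P.map (normalizedSum X n))) atTop (𝓝 0) →
      Tendsto (hessianMatrix (logLaplace P (X 0))) (comap (gaussGap P (X 0)) (𝓝 0)) (𝓝 1) :=
    fun hT => tendsto_hessianMatrix_logLaplace hindep hident hsub fun _ hε =>
      exists_le_of_tendsto_tsallisInf hident hT hε
  have hSD : Tendsto (hessianMatrix (logLaplace P (X 0))) (comap (gaussGap P (X 0)) (𝓝 0)) (𝓝 1) →
      Tendsto (fun t => (hessianMatrix (logLaplace P (X 0)) t).det)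
        (comap (gaussGap P (X 0)) (𝓝 0)) (𝓝 1) := by
    intro hS
    have hdet : Continuous fun M : Matrix (Fin d) (Fin d) ℝ => M.det := continuous_id.matrix_det
    have h := (hdet.tendsto 1).comp hS
    rw [Matrix.det_one] at h
    exact h
  have hDT : Tendsto (fun t => (hessianMatrix (logLaplace P (X 0)) t).det)
        (comap (gaussGap P (X 0)) (𝓝 0)) (𝓝 1) →
      Tendsto (fun n => tsallisInf (P.map (normalizedSum X n))) atTop (𝓝 0) := fun hD =>
    tendsto_tsallisInf_of_eventually_le hident fun _ hε =>
      eventually_sumLaw_le_gaussian hindep hident hsub hk hC hν hD hε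
  have hSA : Tendsto (hessianMatrix (logLaplace P (X 0))) (comap (gaussGap P (X 0)) (𝓝 0)) (𝓝 1) ↔
      Tendsto (hessianMatrix (gaussGap P (X 0))) (comap (gaussGap P (X 0)) (𝓝 0)) (𝓝 0) := by
    have e := funext (hessianMatrix_gaussGap hindep hident hsub)
    constructor <;> intro h
    · rw [e]
      simpa using h.const_sub 1
    · have e' : hessianMatrix (logLaplace P (X 0)) =
          fun t => 1 - hessianMatrix (gaussGap P (X 0)) t := by
        rw [e]; simp
      rw [e']
      simpa using h.const_sub 1
  refine ⟨?_, fun hT => hSD (hTS hT), hDT⟩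
  rw [← tendsto_comap_nhds_zero_iff (continuous_gaussGap hindep hident hsub)
    (continuous_hessianMatrix_gaussGap hindep hident hsub)]
  exact ⟨fun hT => hSA.1 (hTS hT), fun hS => hDT (hSD (hSA.2 hS))⟩
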